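/- Let $k$ be a field. A standard graded $k$-algebra is a commutative graded $k$-algebra $A=\bigoplus_{i\ge 0}A_i$ with $A_0=k$ that is generated, as a $k$-algebra, by the finite-dimensional space $A_1$. Suppose that $A$ is artinian. Then $A$ is Gorenstein if its socle $\{a\in A : A_i\,a=0 \text{ for all } i>0\}$ is one-dimensional over $k$; in this case its $h$-vector is $(h_0,h_1,\dots,h_e)$, where $h_i=\dim_k A_i$ and $e$, the socle degree, is the largest index with $A_e\neq 0$; the number $h_1$ is called the codimension. Such tuples are called Gorenstein $h$-vectors (over $k$). For positive integers $n$ and $i$, write the (unique) $i$-binomial expansion of $n$ as $$n=\binom{n_i}{i}+\binom{n_{i-1}}{i-1}+\dots+\binom{n_j}{j},\qquad n_i>n_{i-1}>\dots>n_j\ge j\ge 1,$$ and for integers $a,b$ put $$(n_{(i)})_a^b=\binom{n_i+b}{i+a}+\binom{n_{i-1}+b}{i-1+a}+\dots+\binom{n_j+b}{j+a},$$ where $\binom{m}{q}=0$ whenever $m<q$ or $q<0$. **Theorem 4.** Let $r\ge 2$ and $e\ge 4$ be integers. Then there are Gorenstein $h$-vectors over $k$ of codimension $r$ and socle degree $e$,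 and the least value $f(r,e)$ of the degree two entry $h_2$ among them satisfies $$f(r,e)\;\ge\;(r_{(e-1)})_{-1}^{-1}+(r_{(e-1)})_{-(e-3)}^{-(e-2)}.$$ -/

import Mathlib

universe u

/-! Binomial expansions -/

/-- The binomial coefficient of two integers, with the convention that it vanishes
whenever `m < q` or `q < 0`. -/
def intChoose (m q : ℤ) : ℕ :=
  if m < q ∨ q < 0 then 0 else m.toNat.choose q.toNat

/-- `n = C(t i, i) + C(t (i-1), i-1) + ... + C(t j, j)` with
`t i > t (i-1) > ... > t j ≥ j ≥ 1`, the `i`-binomial expansion of `n`. -/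
structure IsBinomialExpansion (n i j : ℕ) (t : ℕ → ℕ) : Prop where
  one_le : 1 ≤ j
  le : j ≤ i
  strictMono : StrictMonoOn t (Set.Icc j i)
  le_bot : j ≤ t j
  sum_eq : n = ∑ l ∈ Finset.Icc j i, (t l).choose l

theorem IsBinomialExpansion.exists {n i : ℕ} (hn : 0 < n) (hi : 0 < i) :
    ∃ (j : ℕ) (t : ℕ → ℕ), IsBinomialExpansion n i j t := by
  induction i generalizing n with
  | zero => omega
  | succ i ih =>
    have hb : ∀ m, (m + (i + 1)).choose (i + 1) ≤ n → m ≤ n := by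
      intro m hm
      have h1 : m + 1 ≤ (m + (i + 1)).choose (i + 1) := by
        have h2 : (m + 1).choose m ≤ (m + (i + 1)).choose m :=
          Nat.choose_le_choose m (by omega)
        rw [Nat.choose_succ_self_right] at h2
        rwa [Nat.choose_symm_add] at h2
      omega
    obtain ⟨m, hm1, hm2⟩ : ∃ m, (m + (i + 1)).choose (i + 1) ≤ n ∧
        n < (m + 1 + (i + 1)).choose (i + 1) := by
      let P : ℕ → Prop := fun m => (m + (i + 1)).choose (i + 1) ≤ n
      have h0 : P 0 := by
        change (0 + (i + 1)).choose (i + 1) ≤ n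
        simp
        omega
      refine ⟨Nat.findGreatest P n, Nat.findGreatest_spec (Nat.zero_le n) h0, ?_⟩
      by_contra hc
      push Not at hc
      have h3 : P (Nat.findGreatest P n + 1) := hc
      have h4 := Nat.le_findGreatest (hb _ hc) h3
      omega
    set T := m + (i + 1) with hT
    have hpas : (m + 1 + (i + 1)).choose (i + 1) = T.choose i + T.choose (i + 1) := by
      rw [show m + 1 + (i + 1) = T + 1 by omega, Nat.choose_succ_succ']
    rcases Nat.eq_zero_or_pos (n - T.choose (i + 1)) with h0 | hpos
    · refine ⟨i + 1, fun _ => T, by omega, le_rfl, ?_, by omega, ?_⟩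
      · intro a ha b hb' hab
        simp only [Set.mem_Icc] at ha hb'
        omega
      · simp
        omega
    · have hi0 : 0 < i := by
        rcases Nat.eq_zero_or_pos i with h | h
        · subst h
          simp at hpas hpos hm2
          omega
        · exact h
      obtain ⟨j, t, h⟩ := ih hpos hi0
      have hji := h.le
      have htop : t i < T := by
        by_contra hc
        push Not at hc
        have h5 : T.choose i ≤ (t i).choose i := Nat.choose_le_choose i hc
        have h6 : (t i).choose i ≤ ∑ l ∈ Finset.Icc j i, (t l).choose l :=
          Finset.single_le_sum (f := fun l => (t l).choose l) (fun _ _ => Nat.zero_le _)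
            (Finset.mem_Icc.2 ⟨h.le, le_rfl⟩)
        have h7 := h.sum_eq
        omega
      refine ⟨j, Function.update t (i + 1) T, h.one_le, by omega, ?_, ?_, ?_⟩
      · intro a ha b hb' hab
        simp only [Set.mem_Icc] at ha hb'
        have ha' : a ≠ i + 1 := by omega
        rw [Function.update_of_ne ha']
        by_cases hbi : b = i + 1
        · subst hbi
          rw [Function.update_self]
          refine lt_of_le_of_lt ?_ htop
          exact h.strictMono.monotoneOn ⟨ha.1, by omega⟩ ⟨h.le, le_rfl⟩ (by omega)
        · rw [Function.update_of_ne hbi]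
          exact h.strictMono ⟨ha.1, by omega⟩ ⟨hb'.1, by omega⟩ hab
      · rw [Function.update_of_ne (by omega)]
        exact h.le_bot
      · rw [Finset.sum_Icc_succ_top (by omega), Function.update_self]
        have : ∑ l ∈ Finset.Icc j i, (Function.update t (i + 1) T l).choose l
            = ∑ l ∈ Finset.Icc j i, (t l).choose l := by
          refine Finset.sum_congr rfl fun l hl => ?_
          rw [Finset.mem_Icc] at hl
          rw [Function.update_of_ne (by omega)]
        rw [this, ← h.sum_eq]
        omega

theorem IsBinomialExpansion.lt_choose {n i j : ℕ} {t : ℕ → ℕ}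
    (h : IsBinomialExpansion n i j t) : n < (t i + 1).choose i := by
  induction i generalizing n with
  | zero =>
    have := h.one_le
    have := h.le
    omega
  | succ i ih =>
    have hle := h.le
    have h1 := h.one_le
    have hji : j ≤ t j := h.le_bot
    rw [h.sum_eq]
    rcases Nat.lt_or_ge i j with hlt | hge
    · have : j = i + 1 := by omega
      subst this
      rw [Finset.Icc_self, Finset.sum_singleton, Nat.choose_succ_succ']
      have := Nat.choose_pos (show i ≤ t (i + 1) by omega)
      omega
    · have h' : IsBinomialExpansion (∑ l ∈ Finset.Icc j i, (t l).choose l) i j t :=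
        ⟨h.one_le, hge, h.strictMono.mono (Set.Icc_subset_Icc_right (by omega)), h.le_bot, rfl⟩
      have h2 := ih h'
      have h3 : t i < t (i + 1) := h.strictMono ⟨hge, by omega⟩ ⟨hle, le_rfl⟩ (by omega)
      have h4 : (t i + 1).choose i ≤ (t (i + 1)).choose i := Nat.choose_le_choose i h3
      rw [Finset.sum_Icc_succ_top (by omega), Nat.choose_succ_succ']
      omega

theorem IsBinomialExpansion.unique {n i j j' : ℕ} {t t' : ℕ → ℕ}
    (h : IsBinomialExpansion n i j t) (h' : IsBinomialExpansion n i j' t') :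
    j = j' ∧ ∀ l ∈ Finset.Icc j i, t l = t' l := by
  have key : ∀ {n i j j' : ℕ} {t t' : ℕ → ℕ}, IsBinomialExpansion n i j t →
      IsBinomialExpansion n i j' t' → t i ≤ t' i := by
    intro n i j j' t t' h h'
    by_contra hc
    push Not at hc
    have h1 := h'.lt_choose
    have h2 : (t' i + 1).choose i ≤ (t i).choose i := Nat.choose_le_choose i hc
    have h3 : (t i).choose i ≤ ∑ l ∈ Finset.Icc j i, (t l).choose l :=
      Finset.single_le_sum (f := fun l => (t l).choose l) (fun _ _ => Nat.zero_le _)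
        (Finset.mem_Icc.2 ⟨h.le, le_rfl⟩)
    have h4 := h.sum_eq
    omega
  have pos : ∀ {n i j : ℕ} {t : ℕ → ℕ}, IsBinomialExpansion n i j t → 0 < n := by
    intro n i j t h
    have h3 : (t j).choose j ≤ ∑ l ∈ Finset.Icc j i, (t l).choose l :=
      Finset.single_le_sum (f := fun l => (t l).choose l) (fun _ _ => Nat.zero_le _)
        (Finset.mem_Icc.2 ⟨le_rfl, h.le⟩)
    have h4 := Nat.choose_pos h.le_bot
    have h5 := h.sum_eq
    omega
  induction i generalizing n with
  | zero =>
    have := h.one_le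
    have := h.le
    omega
  | succ i ih =>
    have htop : t (i + 1) = t' (i + 1) := le_antisymm (key h h') (key h' h)
    have tail : ∀ {j : ℕ} {t : ℕ → ℕ}, IsBinomialExpansion n (i + 1) j t → j ≤ i →
        IsBinomialExpansion (n - (t (i + 1)).choose (i + 1)) i j t := by
      intro j t h hge
      refine ⟨h.one_le, hge, h.strictMono.mono (Set.Icc_subset_Icc_right (by omega)),
        h.le_bot, ?_⟩
      have h5 := h.sum_eq
      rw [Finset.sum_Icc_succ_top (by omega)] at h5
      omega
    have last : ∀ {t : ℕ → ℕ}, IsBinomialExpansion n (i + 1) (i + 1) t →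
        n - (t (i + 1)).choose (i + 1) = 0 := by
      intro t h
      have h5 := h.sum_eq
      rw [Finset.Icc_self, Finset.sum_singleton] at h5
      omega
    have hle := h.le
    have hle' := h'.le
    rcases Nat.lt_or_ge i j with hj | hj <;> rcases Nat.lt_or_ge i j' with hj' | hj'
    · have e1 : j = i + 1 := by omega
      have e2 : j' = i + 1 := by omega
      subst e1
      refine ⟨e2.symm, fun l hl => ?_⟩
      rw [Finset.Icc_self, Finset.mem_singleton] at hl
      rw [hl, htop]
    · have e1 : j = i + 1 := by omega
      subst e1
      have a := last h
      have b := pos (tail h' hj')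
      rw [htop] at a
      omega
    · have e1 : j' = i + 1 := by omega
      subst e1
      have a := last h'
      have b := pos (tail h hj)
      rw [htop] at b
      omega
    · have h2 := tail h' hj'
      rw [← htop] at h2
      obtain ⟨e1, e2⟩ := ih (tail h hj) h2
      refine ⟨e1, fun l hl => ?_⟩
      rw [Finset.mem_Icc] at hl
      rcases Nat.lt_or_ge i l with hl' | hl'
      · rw [show l = i + 1 by omega, htop]
      · exact e2 l (Finset.mem_Icc.2 ⟨hl.1, hl'⟩)

open Classical in
/-- `(n_{(i)})_a^b = C(t i + b, i + a) + ... + C(t j + b, j + a)`, where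
`n = C(t i, i) + ... + C(t j, j)` is the `i`-binomial expansion of `n`, which exists
and is unique for positive `n` and `i` (the value is `0` otherwise). -/
noncomputable def binomialShift (n i : ℕ) (a b : ℤ) : ℕ :=
  if h : ∃ p : ℕ × (ℕ → ℕ), IsBinomialExpansion n i p.1 p.2 then
    ∑ l ∈ Finset.Icc h.choose.1 i, intChoose ((h.choose.2 l : ℤ) + b) ((l : ℤ) + a)
  else 0

theorem IsBinomialExpansion.binomialShift_eq {n i j : ℕ} {t : ℕ → ℕ}
    (h : IsBinomialExpansion n i j t) (a b : ℤ) :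
    binomialShift n i a b = ∑ l ∈ Finset.Icc j i, intChoose ((t l : ℤ) + b) ((l : ℤ) + a) := by
  have hex : ∃ p : ℕ × (ℕ → ℕ), IsBinomialExpansion n i p.1 p.2 := ⟨(j, t), h⟩
  rw [binomialShift, dif_pos hex]
  obtain ⟨e1, e2⟩ := hex.choose_spec.unique h
  rw [← e1]
  exact Finset.sum_congr rfl fun l hl => by rw [e2 l hl]

/-! Graded algebras -/

section Graded

variable {k : Type u} [Field k] {A : Type u} [CommRing A] [Algebra k A]

/-- A standard graded `k`-algebra: `A_0 = k`, and `A` is generated as a `k`-algebra by the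
finite-dimensional space `A_1`. -/
structure IsStandardGraded (𝒜 : ℕ → Submodule k A) [GradedAlgebra 𝒜] : Prop where
  nontrivial : Nontrivial A
  zero_eq : 𝒜 0 = 1
  finite_one : Module.Finite k (𝒜 1)
  adjoin_one : Algebra.adjoin k (𝒜 1 : Set A) = ⊤

/-- The socle: the annihilator of the irrelevant ideal `A_1 + A_2 + ...`. -/
def gradedSocle (𝒜 : ℕ → Submodule k A) : Submodule k A where
  carrier := {a | ∀ i, 0 < i → ∀ x ∈ 𝒜 i, x * a = 0}
  zero_mem' := fun _ _ _ _ => mul_zero _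
  add_mem' := fun ha hb i hi x hx => by rw [mul_add, ha i hi x hx, hb i hi x hx, add_zero]
  smul_mem' := fun c a ha i hi x hx => by rw [mul_smul_comm, ha i hi x hx, smul_zero]

/-- An artinian Gorenstein standard graded `k`-algebra: artinian, with one-dimensional socle. -/
structure IsArtinianGorenstein (𝒜 : ℕ → Submodule k A) [GradedAlgebra 𝒜] : Prop where
  standard : IsStandardGraded 𝒜
  artinian : IsArtinianRing A
  socle : Module.finrank k (gradedSocle 𝒜) = 1

end Graded

/-- `h` is the `h`-vector (extended by zero) of an artinian Gorenstein standard graded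
`k`-algebra. -/
def IsGorensteinHVector (k : Type u) [Field k] (h : ℕ → ℕ) : Prop :=
  ∃ (A : Type u) (_ : CommRing A) (_ : Algebra k A) (𝒜 : ℕ → Submodule k A)
    (_ : GradedAlgebra 𝒜), IsArtinianGorenstein 𝒜 ∧ ∀ i, h i = Module.finrank k (𝒜 i)

/-- The degree two entries `h_2` of the Gorenstein `h`-vectors `(1, r, h_2, ..., h_e)` over `k`
of codimension `r` and socle degree `e`. -/
def gorensteinDegreeTwoEntries (k : Type u) [Field k] (r e : ℕ) : Set ℕ :=
  {m | ∃ h : ℕ → ℕ, IsGorensteinHVector k h ∧ h 1 = r ∧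
    h e ≠ 0 ∧ (∀ i, e < i → h i = 0) ∧ h 2 = m}

/-- `f(r,e)` over the field `k`. -/
noncomputable def leastDegreeTwoEntry (k : Type u) [Field k] (r e : ℕ) : ℕ :=
  sInf (gorensteinDegreeTwoEntries k r e)

/-!
The bound compares the multiplication maps `ℓ : A_1 → A_2` and `ℓ : A_{e-2} → A_{e-1}` of a general
linear form `ℓ`. By Gorenstein duality the second is the transpose of the first, so both have the
same rank, say `b`. Put `c_i = dim A_i / ℓ A_{i-1}`; then `r - c_{e-1} = b` and `h_2 = b + c_2`.
Green's hyperplane restriction theorem gives `c_{e-1} ≤ r_{⟨e-1⟩}`, and Macaulay's theorem for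
`A / ℓ A` bounds `c_2` from below by a function of `c_{e-1}` which is `1`-Lipschitz. Hence
`h_2 = r - c_{e-1} + c_2` is smallest when `c_{e-1}` is as large as Green's theorem allows, and the
two resulting terms are the two binomial sums (`binomialShift_add_binomialShift_le`).

Green's theorem (`codimIn_sup_mulSub_le_greenBound`) is proved for subspaces `W` of `L ^ d`, where
`L` is a finite-dimensional subspace of any commutative algebra over an infinite field. With
`W : ℓ` the colon space and `g` a second general element, `c = codim W` and
`b = codim (W + ℓ L ^ (d - 1))` satisfy `b ≤ b_{⟨d⟩} + (c - b)_{⟨d-1⟩}` by induction, and this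
inequality alone forces `b ≤ c_{⟨d⟩}` (`le_greenBound_add`). Macaulay's theorem follows from Green's
by counting dimensions. General elements are handled by `IsLineOpen`. An arbitrary field is
replaced by its algebraic closure; the only consequence of the Gorenstein property that is used, a
functional `φ` such that `φ (u x) = 0` for all `x ∈ A_1` forces `u = 0` in `A_{e-1}`, survives this.

Gorenstein `h`-vectors with the given `r` and `e` exist: divide the polynomial ring by the apolar
ideal of the functional that adds up the coefficients of `x_1 ^ e, ..., x_r ^ e`.
-/

open Module TensorProduct

/-! ### Green's function `n ↦ n_{⟨d⟩}` -/

theorem le_add_choose (n d : ℕ) : n + 1 ≤ (n + (d + 1)).choose (d + 1) := by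
  have h2 : (n + 1).choose n ≤ (n + (d + 1)).choose n := Nat.choose_le_choose n (by omega)
  rwa [Nat.choose_succ_self_right, Nat.choose_symm_add] at h2

/-- The top entry of the `(d + 1)`-binomial expansion of `n`: the largest `T` with
`C(T, d + 1) ≤ n`. -/
def binomialTop (d n : ℕ) : ℕ := Nat.findGreatest (fun T => T.choose (d + 1) ≤ n) (n + d)

theorem binomialTop_spec {d n : ℕ} (hn : 0 < n) :
    d + 1 ≤ binomialTop d n ∧ (binomialTop d n).choose (d + 1) ≤ n ∧
      n < (binomialTop d n + 1).choose (d + 1) := by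
  have h1 : (d + 1).choose (d + 1) ≤ n := by rw [Nat.choose_self]; exact hn
  refine ⟨Nat.le_findGreatest (by omega) h1,
    Nat.findGreatest_spec (P := fun T => T.choose (d + 1) ≤ n) (m := d + 1) (by omega) h1, ?_⟩
  by_contra hc
  push Not at hc
  have hle : binomialTop d n + 1 ≤ n + d := by
    by_contra h
    have h3 := Nat.choose_le_choose (d + 1) (show n + (d + 1) ≤ binomialTop d n + 1 by omega)
    have := le_add_choose n d
    omega
  have : binomialTop d n + 1 ≤ binomialTop d n := Nat.le_findGreatest hle hc
  omega

theorem binomialTop_eq {d n T : ℕ} (h1 : T.choose (d + 1) ≤ n)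
    (h2 : n < (T + 1).choose (d + 1)) : binomialTop d n = T := by
  have hT : d ≤ T := by
    by_contra h
    rw [Nat.choose_eq_zero_of_lt (show T + 1 < d + 1 by omega)] at h2
    omega
  rcases Nat.eq_zero_or_pos n with h | hn
  · subst h
    have : T < d + 1 := Nat.choose_eq_zero_iff.1 (Nat.le_zero.1 h1)
    have hTd : T = d := by omega
    subst hTd
    apply le_antisymm
    · exact (Nat.findGreatest_le _).trans_eq (zero_add T)
    · exact Nat.le_findGreatest (by omega) h1
  obtain ⟨-, h3, h4⟩ := binomialTop_spec (d := d) hn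
  apply le_antisymm
  · by_contra h
    have := Nat.choose_le_choose (d + 1) (show T + 1 ≤ binomialTop d n by omega)
    omega
  · by_contra h
    have := Nat.choose_le_choose (d + 1) (show binomialTop d n + 1 ≤ T by omega)
    omega

/-- Green's function `n ↦ n_{⟨d⟩} = (n_{(d)})_0^{-1}`, computed by the greedy algorithm that
produces the binomial expansion. The convention in degree `0` is the one for which
`greenBound_add` holds for `d = 0`, including the right end point of the interval. -/
def greenBound : ℕ → ℕ → ℕ
  | 0, n => n
  | d + 1, n => (binomialTop d n - 1).choose (d + 1) +
      greenBound d (n - (binomialTop d n).choose (d + 1))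

theorem greenBound_zero_right (d : ℕ) : greenBound d 0 = 0 := by
  induction d with
  | zero => rfl
  | succ d ih =>
    have : binomialTop d 0 = d := binomialTop_eq (by simp) (by simp)
    rw [greenBound, this, Nat.choose_eq_zero_of_lt (by omega), Nat.zero_sub, ih]

/-- The value of `n_{⟨d⟩}` at a binomial coefficient `n = C(T, d)`. -/
theorem greenBound_choose {d T : ℕ} (hT : d ≤ T) :
    greenBound d (T.choose d) = (T - 1).choose d := by
  cases d with
  | zero => simp [greenBound]
  | succ d =>
    have : binomialTop d (T.choose (d + 1)) = T := by
      refine binomialTop_eq le_rfl ?_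
      rw [Nat.choose_succ_succ']
      have := Nat.choose_pos (show d ≤ T by omega)
      omega
    rw [greenBound, this, Nat.sub_self, greenBound_zero_right, add_zero]

/-- The recursion for `n_{⟨d⟩}` remains valid at the right end point of the interval
`[C(T, d + 1), C(T + 1, d + 1)]`. -/
theorem greenBound_add {d T x : ℕ} (hT : d + 1 ≤ T) (hx : x ≤ T.choose d) :
    greenBound (d + 1) (T.choose (d + 1) + x) = (T - 1).choose (d + 1) + greenBound d x := by
  rcases hx.lt_or_eq with hx | rfl
  · have : binomialTop d (T.choose (d + 1) + x) = T := by
      refine binomialTop_eq (by omega) ?_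
      rw [Nat.choose_succ_succ']
      omega
    rw [greenBound, this, Nat.add_sub_cancel_left]
  · obtain ⟨S, rfl⟩ : ∃ S, T = S + 1 := ⟨T - 1, by omega⟩
    rw [add_comm ((S + 1).choose (d + 1)), ← Nat.choose_succ_succ',
      greenBound_choose (by omega), greenBound_choose (by omega)]
    simp only [Nat.add_sub_cancel]
    rw [Nat.choose_succ_succ', add_comm]

/-- The greedy first step of a binomial expansion. -/
theorem exists_eq_choose_add {d n : ℕ} (hn : 0 < n) :
    ∃ T x, d + 1 ≤ T ∧ x < T.choose d ∧ n = T.choose (d + 1) + x := by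
  obtain ⟨h1, h2, h3⟩ := binomialTop_spec (d := d) hn
  rw [Nat.choose_succ_succ'] at h3
  exact ⟨_, n - (binomialTop d n).choose (d + 1), h1, by omega, by omega⟩

/-- The increments of `n ↦ n_{⟨d⟩}` are `0` or `1`. -/
theorem greenBound_succ_right (d n : ℕ) :
    greenBound d n ≤ greenBound d (n + 1) ∧ greenBound d (n + 1) ≤ greenBound d n + 1 := by
  induction d generalizing n with
  | zero => simp [greenBound]
  | succ d ih =>
    rcases Nat.eq_zero_or_pos n with rfl | hn
    · have h := greenBound_choose (d := d + 1) (T := d + 1) le_rfl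
      rw [Nat.choose_self] at h
      rw [greenBound_zero_right, zero_add, h, Nat.choose_eq_zero_of_lt (by omega)]
      omega
    · obtain ⟨T, x, hT, hx, rfl⟩ := exists_eq_choose_add (d := d) hn
      rw [add_assoc, greenBound_add hT hx.le, greenBound_add hT (show x + 1 ≤ T.choose d from hx)]
      have := ih x
      omega

theorem greenBound_mono (d : ℕ) : Monotone (greenBound d) :=
  monotone_nat_of_le_succ fun n => (greenBound_succ_right d n).1

theorem sub_greenBound_mono (d : ℕ) : Monotone fun n => n - greenBound d n :=
  monotone_nat_of_le_succ fun n => by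
    have := (greenBound_succ_right d n).2
    omega

theorem greenBound_le (d n : ℕ) : greenBound d n ≤ n := by
  induction n with
  | zero => rw [greenBound_zero_right]
  | succ n ih =>
    have := (greenBound_succ_right d n).2
    omega

theorem greenBound_one {n : ℕ} : greenBound 1 n = n - 1 := by
  rcases Nat.eq_zero_or_pos n with rfl | hn
  · rw [greenBound_zero_right]
  · have := greenBound_choose (d := 1) (T := n) hn
    simpa using this

/-- For `T > d` the value of `n_{⟨d⟩}` jumps exactly at `n = C(T, d)`. -/
theorem greenBound_choose_sub_one {d T : ℕ} (hT : d < T) (hd : 0 < d) :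
    greenBound d (T.choose d - 1) + 1 = (T - 1).choose d := by
  induction d generalizing T with
  | zero => omega
  | succ d ih =>
    rcases Nat.eq_zero_or_pos d with rfl | hd'
    · simp only [zero_add, Nat.choose_one_right, greenBound_one]
      omega
    · obtain ⟨S, rfl⟩ : ∃ S, T = S + 1 := ⟨T - 1, by omega⟩
      obtain ⟨S, rfl⟩ : ∃ U, S = U + 1 := ⟨S - 1, by omega⟩
      have hpos := Nat.choose_pos (show d ≤ S + 1 by omega)
      have h1 := ih (T := S + 1) (by omega) hd'
      have h2 : (S + 1 + 1).choose (d + 1) - 1 =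
          (S + 1).choose (d + 1) + ((S + 1).choose d - 1) := by
        rw [Nat.choose_succ_succ' (S + 1)]
        omega
      rw [h2, greenBound_add (by omega) (by omega)]
      simp only [Nat.add_sub_cancel] at h1 ⊢
      rw [Nat.choose_succ_succ']
      omega

/-- The arithmetic step in Green's theorem: the inequality `b ≤ b_{⟨d+1⟩} + a_{⟨d⟩}`, obtained by
comparing two hyperplane sections, implies `b ≤ (a + b)_{⟨d+1⟩}`. -/
theorem le_greenBound_add {d a b : ℕ}
    (h : b ≤ greenBound (d + 1) b + greenBound d a) : b ≤ greenBound (d + 1) (a + b) := by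
  induction d generalizing a b with
  | zero =>
    rw [greenBound_one] at h ⊢
    simp only [greenBound] at h
    omega
  | succ d ih =>
    rcases Nat.eq_zero_or_pos b with rfl | hb
    · exact Nat.zero_le _
    obtain ⟨S, b', hS, hb', rfl⟩ := exists_eq_choose_add (d := d + 1) hb
    obtain ⟨U, rfl⟩ : ∃ U, S = U + 1 := ⟨S - 1, by omega⟩
    rw [greenBound_add hS hb'.le] at h
    simp only [Nat.add_sub_cancel] at h
    have hp := Nat.choose_succ_succ' U (d + 1)
    have hle' := greenBound_le (d + 1) b'
    have hlow : U.choose (d + 1) ≤ greenBound (d + 1) a := by omega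
    -- `a_{⟨d+1⟩}` reaches `C(U, d + 1)` only from `a = C(U + 1, d + 1)` on
    have ha : (U + 1).choose (d + 1) ≤ a := by
      by_contra hc
      have h1 := greenBound_choose_sub_one (d := d + 1) (T := U + 1) (by omega) (by omega)
      have h2 := greenBound_mono (d + 1) (show a ≤ (U + 1).choose (d + 1) - 1 by omega)
      simp only [Nat.add_sub_cancel] at h1
      omega
    obtain ⟨a', rfl⟩ : ∃ a', a = (U + 1).choose (d + 1) + a' := ⟨_, (Nat.add_sub_cancel' ha).symm⟩
    have hp2 := Nat.choose_succ_succ' (U + 1) (d + 1)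
    have key : b' ≤ greenBound (d + 1) (a' + b') := by
      rcases le_or_gt a' ((U + 1).choose d) with h1 | h1
      · rw [greenBound_add (by omega) h1] at h
        simp only [Nat.add_sub_cancel] at h
        exact ih (by omega)
      · -- replace `a'` by the right end point of the interval on which the recursion holds
        have h2 : greenBound d ((U + 1).choose d) = U.choose d :=
          greenBound_choose (by omega)
        have h3 : b' - greenBound (d + 1) b' ≤ _ := sub_greenBound_mono (d + 1) hb'.le
        simp only [greenBound_choose (show d + 1 ≤ U + 1 by omega),
          Nat.add_sub_cancel] at h3
        have hp3 := Nat.choose_succ_succ' U d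
        refine (ih (a := (U + 1).choose d) (b := b') (by omega)).trans
          (greenBound_mono _ (by omega))
    have hsum : (U + 1).choose (d + 1) + a' + ((U + 1).choose (d + 1 + 1) + b') =
        (U + 1 + 1).choose (d + 1 + 1) + (a' + b') := by omega
    rw [hsum]
    rcases le_or_gt (a' + b') ((U + 1 + 1).choose (d + 1)) with h1 | h1
    · rw [greenBound_add (by omega) h1]
      simp only [Nat.add_sub_cancel]
      omega
    · -- here `a + b ≥ C(U + 3, d + 2)`, and monotonicity is enough
      have h2 := greenBound_mono (d + 1 + 1) (show (U + 1 + 1 + 1).choose (d + 1 + 1) ≤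
        (U + 1 + 1).choose (d + 1 + 1) + (a' + b') by
          rw [Nat.choose_succ_succ' (U + 1 + 1)]; omega)
      rw [greenBound_choose (by omega)] at h2
      simp only [Nat.add_sub_cancel] at h2
      omega

/-! ### Binomial expansions and the iterated Macaulay bound -/

/-- The dimension `c - c_{⟨i⟩}` forced in degree `i - 1` by dimension `c` in degree `i`, iterated
from degree `i = s + 2` down to degree `2`. -/
def macaulayDescent : ℕ → ℕ → ℕ
  | 0, n => n
  | s + 1, n => macaulayDescent s (n - greenBound (s + 3) n)

theorem macaulayDescent_mono (s : ℕ) : Monotone (macaulayDescent s) := by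
  induction s with
  | zero => exact fun _ _ h => h
  | succ s ih => exact fun a b h => ih (sub_greenBound_mono _ h)

/-- The descent is `1`-Lipschitz. -/
theorem macaulayDescent_le_add (s : ℕ) {a b : ℕ} (h : a ≤ b) :
    macaulayDescent s b ≤ macaulayDescent s a + (b - a) := by
  induction s generalizing a b with
  | zero => simp only [macaulayDescent]; omega
  | succ s ih =>
    have h1 : a - greenBound (s + 3) a ≤ b - greenBound (s + 3) b := sub_greenBound_mono _ h
    have h2 := greenBound_mono (s + 3) h
    have h3 := ih h1
    have h4 := greenBound_le (s + 3) a
    have h5 := greenBound_le (s + 3) b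
    simp only [macaulayDescent]
    omega

/-- The lower terms of a binomial expansion satisfy the bound required by `greenBound_add`. -/
theorem sum_Icc_choose_lt {i j : ℕ} {t : ℕ → ℕ} (h1 : 1 ≤ j) (hji : j ≤ i + 1)
    (ht : StrictMonoOn t (Set.Icc j (i + 1))) (hj : j ≤ t j) :
    ∑ l ∈ Finset.Icc j i, (t l).choose l < (t (i + 1)).choose i := by
  rcases hji.eq_or_lt with rfl | hlt
  · rw [Finset.Icc_eq_empty (by omega), Finset.sum_empty]
    exact Nat.choose_pos (by omega)
  · have h : IsBinomialExpansion (∑ l ∈ Finset.Icc j i, (t l).choose l) i j t :=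
      ⟨h1, by omega, ht.mono (Set.Icc_subset_Icc_right (by omega)), hj, rfl⟩
    refine h.lt_choose.trans_le (Nat.choose_le_choose i ?_)
    exact ht ⟨by omega, by omega⟩ ⟨hji, le_rfl⟩ (by omega)

/-- The value of `n_{⟨i⟩}` on a sum of binomial coefficients that is a binomial expansion. -/
theorem greenBound_sum {i j : ℕ} {t : ℕ → ℕ} (h1 : 1 ≤ j) (hji : j ≤ i + 1)
    (ht : StrictMonoOn t (Set.Icc j i)) (hj : j ≤ i → j ≤ t j) :
    greenBound i (∑ l ∈ Finset.Icc j i, (t l).choose l) =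
      ∑ l ∈ Finset.Icc j i, (t l - 1).choose l := by
  induction i with
  | zero => rw [Finset.Icc_eq_empty (by omega)]; simp [greenBound]
  | succ i ih =>
    rcases hji.eq_or_lt with rfl | hlt
    · rw [Finset.Icc_eq_empty (by omega)]
      simp [greenBound_zero_right]
    have hle : j ≤ i + 1 := by omega
    have hji' : ∀ l ∈ Set.Icc j (i + 1), l ≤ t l := fun l hl => by
      obtain ⟨hl1, hl2⟩ := hl
      induction l, hl1 using Nat.le_induction with
      | base => exact hj hle
      | succ l hl1 ihl =>
        have := ihl (by omega)
        have := ht (⟨hl1, by omega⟩ : l ∈ Set.Icc j (i + 1)) ⟨by omega, hl2⟩ (Nat.lt_succ_self l)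
        omega
    rw [Finset.sum_Icc_succ_top hle, Finset.sum_Icc_succ_top hle,
      add_comm (∑ l ∈ Finset.Icc j i, (t l).choose l),
      greenBound_add (hji' _ ⟨hle, le_rfl⟩) (sum_Icc_choose_lt h1 hle ht (hj hle)).le,
      ih (by omega) (ht.mono (Set.Icc_subset_Icc_right (by omega))) (fun _ => hj hle), add_comm]

theorem sum_choose_sub_greenBound {i j : ℕ} {t : ℕ → ℕ} (h1 : 1 ≤ j) (hji : j ≤ i + 1)
    (ht : StrictMonoOn t (Set.Icc j i)) (hj : ∀ l ∈ Set.Icc j i, l ≤ t l) :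
    ∑ l ∈ Finset.Icc j i, (t l).choose l -
      greenBound i (∑ l ∈ Finset.Icc j i, (t l).choose l) =
      ∑ l ∈ Finset.Icc j i, (t l - 1).choose (l - 1) := by
  rw [greenBound_sum h1 hji ht fun h => hj j ⟨le_rfl, h⟩, Nat.sub_eq_iff_eq_add, add_comm,
    ← Finset.sum_add_distrib]
  · refine Finset.sum_congr rfl fun l hl => ?_
    rw [Finset.mem_Icc] at hl
    have := hj l hl
    obtain ⟨a, ha⟩ : ∃ a, t l = a + 1 := ⟨t l - 1, by omega⟩
    obtain ⟨b, rfl⟩ : ∃ b, l = b + 1 := ⟨l - 1, by omega⟩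
    rw [ha]
    simp only [Nat.add_sub_cancel]
    rw [Nat.choose_succ_succ', add_comm]
  · exact Finset.sum_le_sum fun l _ => Nat.choose_le_choose l (Nat.sub_le _ _)

/-- A lower bound for the descent in terms of a binomial expansion of the argument. The descent
starts in degree `s + 3`; terms of index less than `s + 1` do not reach degree `2`. -/
theorem sum_le_macaulayDescent {s j N : ℕ} {t : ℕ → ℕ} (h1 : 1 ≤ j) (hji : j ≤ s + 4)
    (ht : StrictMonoOn t (Set.Icc j (s + 3))) (hj : ∀ l ∈ Set.Icc j (s + 3), l ≤ t l)
    (hN : ∑ l ∈ Finset.Icc j (s + 3), (t l).choose l ≤ N) :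
    ∑ l ∈ Finset.Icc (max j (s + 1)) (s + 3), (t l - (s + 1)).choose (l - (s + 1)) ≤
      macaulayDescent (s + 1) N := by
  induction s generalizing j N t with
  | zero =>
    have h : _ ≤ N - greenBound 3 N := sub_greenBound_mono 3 hN
    simp only [sum_choose_sub_greenBound h1 hji ht hj] at h
    simpa [macaulayDescent, Nat.max_eq_left h1] using h
  | succ s ih =>
    have h : _ ≤ N - greenBound (s + 4) N := sub_greenBound_mono (s + 4) hN
    have h' := sum_choose_sub_greenBound h1 hji ht hj
    simp only [h'] at h
    have hshift : ∀ (f : ℕ → ℕ) (a : ℕ), 2 ≤ a → ∑ l ∈ Finset.Icc a (s + 4), f l =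
        ∑ l ∈ Finset.Icc (a - 1) (s + 3), f (l + 1) := fun f a ha => by
      obtain ⟨b, rfl⟩ : ∃ b, a = b + 1 := ⟨a - 1, by omega⟩
      rw [Nat.add_sub_cancel, ← Finset.sum_image (f := f) (g := fun l => l + 1)
        (fun _ _ _ _ h => Nat.succ_injective h), Finset.image_add_right_Icc]
    -- a term of index `1` becomes `C(t 1 - 1, 0) = 1`, which is not part of an expansion in degree
    -- `s + 3`; it is dropped, since it does not occur in the claim
    have h2 : ∑ l ∈ Finset.Icc (max (j - 1) 1) (s + 3), (t (l + 1) - 1).choose l ≤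
        N - greenBound (s + 4) N := by
      refine le_trans ?_ h
      have := hshift (fun l => (t l - 1).choose (l - 1)) (max j 2) (le_max_right _ _)
      simp only [Nat.add_sub_cancel] at this
      rw [show max (j - 1) 1 = max j 2 - 1 by omega, ← this]
      exact Finset.sum_le_sum_of_subset (Finset.Icc_subset_Icc_left (le_max_left _ _))
    have h3 := ih (j := max (j - 1) 1) (t := fun l => t (l + 1) - 1) (le_max_right _ _) (by omega)
      (fun a ha b hb hab => by
        simp only [Set.mem_Icc] at ha hb
        have h4 := ht (a := a + 1) (b := b + 1) ⟨by omega, by omega⟩ ⟨by omega, by omega⟩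
          (by omega)
        have h5 := hj (a + 1) ⟨by omega, by omega⟩
        beta_reduce
        omega)
      (fun l hl => by
        simp only [Set.mem_Icc] at hl
        have := hj (l + 1) ⟨by omega, by omega⟩
        omega) h2
    refine le_of_eq_of_le ?_ h3
    rw [hshift _ _ (by omega), show max j (s + 1 + 1) - 1 = max (max (j - 1) 1) (s + 1) by omega]
    refine Finset.sum_congr rfl fun l _ => ?_
    congr 1 <;> omega

theorem intChoose_sub_natCast (m q a b : ℕ) (h : a ≤ m) :
    intChoose ((m : ℤ) + -(a : ℤ)) ((q : ℤ) + -(b : ℤ)) =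
      if b ≤ q then (m - a).choose (q - b) else 0 := by
  unfold intChoose
  split_ifs with h1 h2 h2
  · rw [Nat.choose_eq_zero_of_lt (by omega)]
  · rfl
  · congr 1 <;> omega
  · omega

/-- The lower bound for `h_2`, expressed through Green's bound and the iterated Macaulay bound. -/
theorem binomialShift_add_binomialShift_le {r s : ℕ} (hr : 0 < r) :
    binomialShift r (s + 3) (-1) (-1) +
        binomialShift r (s + 3) (-((s : ℤ) + 1)) (-((s : ℤ) + 2)) ≤
      (r - greenBound (s + 3) r) + macaulayDescent (s + 1) (greenBound (s + 3) r) := by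
  obtain ⟨j, t, h⟩ := IsBinomialExpansion.exists hr (show 0 < s + 3 by omega)
  have hj1 := h.one_le
  have hji := h.le
  have ht := h.strictMono
  have hb : ∀ l ∈ Set.Icc j (s + 3), l ≤ t l := fun l hl => by
    obtain ⟨hl1, hl2⟩ := hl
    induction l, hl1 using Nat.le_induction with
    | base => exact h.le_bot
    | succ l hl1 ihl =>
      have := ihl (by omega)
      have := ht (⟨hl1, by omega⟩ : l ∈ Set.Icc j (s + 3)) ⟨by omega, hl2⟩ (Nat.lt_succ_self l)
      omega
  rw [h.binomialShift_eq, h.binomialShift_eq]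
  refine add_le_add (le_of_eq ?_) ?_
  · rw [h.sum_eq, sum_choose_sub_greenBound hj1 (by omega) ht hb]
    refine Finset.sum_congr rfl fun l hl => ?_
    rw [Finset.mem_Icc] at hl
    have h1 := hb l hl
    have h2 := intChoose_sub_natCast (t l) l 1 1 (by omega)
    rw [Nat.cast_one] at h2
    rw [h2, if_pos (by omega)]
  · -- drop the terms `C(l, l)`, which contribute nothing to either side
    obtain ⟨m, hm1, hm2, hm3, hm4⟩ : ∃ m, j ≤ m ∧ m ≤ s + 4 ∧
        (∀ l ∈ Set.Icc m (s + 3), l < t l) ∧ ∀ l, j ≤ l → l < m → t l = l := by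
      by_cases hex : ∃ m, j ≤ m ∧ m ≤ s + 3 ∧ m < t m
      · classical
        obtain ⟨hf1, hf2, hf3⟩ := Nat.find_spec hex
        refine ⟨Nat.find hex, hf1, by omega, fun l hl => ?_, fun l hl1 hl2 => ?_⟩
        · obtain ⟨hl1, hl2⟩ := hl
          induction l, hl1 using Nat.le_induction with
          | base => exact hf3
          | succ l hl1 ihl =>
            have := ihl (by omega)
            have := ht (⟨by omega, by omega⟩ : l ∈ Set.Icc j (s + 3)) ⟨by omega, hl2⟩
              (Nat.lt_succ_self l)
            omega
        · have h1 := Nat.find_min hex hl2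
          have h2 := hb l ⟨hl1, by omega⟩
          by_contra hc
          exact h1 ⟨hl1, by omega, by omega⟩
      · push Not at hex
        refine ⟨s + 4, by omega, le_rfl, fun l hl => ?_, fun l hl1 hl2 => ?_⟩
        · obtain ⟨hl1, hl2⟩ := hl
          omega
        · exact le_antisymm (hex l hl1 (by omega)) (hb l ⟨hl1, by omega⟩)
    have hdrop : ∀ f : ℕ → ℕ, (∀ l, j ≤ l → l < m → f l = 0) →
        ∑ l ∈ Finset.Icc j (s + 3), f l = ∑ l ∈ Finset.Icc m (s + 3), f l := fun f hf => by
      refine (Finset.sum_subset (Finset.Icc_subset_Icc_left hm1) fun l hl hl' => ?_).symm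
      rw [Finset.mem_Icc] at hl hl'
      exact hf l hl.1 (by omega)
    have hg : greenBound (s + 3) r = ∑ l ∈ Finset.Icc m (s + 3), (t l - 1).choose l := by
      rw [h.sum_eq, greenBound_sum hj1 (by omega) ht fun _ => h.le_bot]
      refine hdrop _ fun l hl1 hl2 => ?_
      have := hm4 l hl1 hl2
      exact Nat.choose_eq_zero_of_lt (by omega)
    have key := sum_le_macaulayDescent (s := s) (j := m) (t := fun l => t l - 1) (by omega) hm2
      (fun a ha b hb' hab => by
        have h1 := hm3 a ha
        have h2 := ht ⟨hm1.trans ha.1, ha.2⟩ ⟨hm1.trans hb'.1, hb'.2⟩ hab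
        beta_reduce
        omega)
      (fun l hl => by
        have := hm3 l hl
        omega) hg.ge
    refine le_of_eq_of_le ?_ key
    have hterm : ∀ l, s + 2 ≤ t l → intChoose ((t l : ℤ) + -((s : ℤ) + 2))
        ((l : ℤ) + -((s : ℤ) + 1)) =
        if s + 1 ≤ l then (t l - (s + 2)).choose (l - (s + 1)) else 0 := fun l hl => by
      have := intChoose_sub_natCast (t l) l (s + 2) (s + 1) hl
      push_cast at this
      exact this
    have hsmall : ∀ l, l < s + 1 → intChoose ((t l : ℤ) + -((s : ℤ) + 2))
        ((l : ℤ) + -((s : ℤ) + 1)) = 0 := fun l hl => if_pos (Or.inr (by omega))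
    rw [hdrop _ fun l hl1 hl2 => ?_]
    · refine (Finset.sum_subset (Finset.Icc_subset_Icc_left (le_max_left m (s + 1)))
        fun l hl hl' => ?_).symm.trans (Finset.sum_congr rfl fun l hl => ?_)
      · rw [Finset.mem_Icc] at hl hl'
        exact hsmall l (by omega)
      · rw [Finset.mem_Icc] at hl
        have := hm3 l ⟨by omega, hl.2⟩
        rw [hterm l (by omega), if_pos (by omega)]
        congr 1
        omega
    · exact if_pos (Or.inl (by rw [hm4 l hl1 hl2]; omega))

/-! ### General elements and dimension counts -/

section LineOpen

variable {K : Type*} [Field K] {V E : Type*} [AddCommGroup V] [Module K V]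
  [AddCommGroup E] [Module K E]

/-- The rank of a member of the pencil `S + t T` is at least the rank of `S`, for all but finitely
many scalars `t`. -/
theorem finite_setOf_finrank_range_add_smul_lt [FiniteDimensional K V] (S T : V →ₗ[K] E) :
    {t : K | finrank K (LinearMap.range (S + t • T)) < finrank K (LinearMap.range S)}.Finite := by
  -- `R` is a section of `S` over its range and `P` a projection onto that range, so that
  -- `P (S + t T) R = 1 + t P T R`, which is injective unless `-1 / t` is an eigenvalue of `P T R`.
  obtain ⟨R, hR⟩ := S.rangeRestrict.exists_rightInverse_of_surjective
    (LinearMap.range_rangeRestrict S)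
  obtain ⟨P, hP⟩ := (LinearMap.range S).subtype.exists_leftInverse_of_injective
    (Submodule.ker_subtype _)
  have hPSR : ∀ v, P (S (R v)) = v := fun v => by
    have h1 : S.rangeRestrict (R v) = v := LinearMap.congr_fun hR v
    have h2 : S (R v) = (LinearMap.range S).subtype v := by
      conv_rhs => rw [← h1]
      rfl
    rw [h2]
    exact LinearMap.congr_fun hP v
  let N : End K (LinearMap.range S) := P ∘ₗ T ∘ₗ R
  refine ((N.finite_hasEigenvalue).image fun μ => -μ⁻¹).subset fun t ht => ?_
  by_contra hc
  rw [Set.mem_ofPred_eq] at ht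
  refine absurd ht (not_lt.2 ?_)
  have hinj : Function.Injective ((S + t • T) ∘ₗ R) := by
    rw [← LinearMap.ker_eq_bot, LinearMap.ker_eq_bot']
    intro v hv
    by_contra hv0
    have h1 : v + t • N v = 0 := by
      have := congrArg P hv
      simpa [hPSR, N] using this
    have ht0 : t ≠ 0 := by
      rintro rfl
      exact hv0 (by simpa using h1)
    refine hc ⟨-t⁻¹, ?_, by simp⟩
    refine Module.End.hasEigenvalue_of_hasEigenvector (x := v) ⟨?_, hv0⟩
    rw [Module.End.mem_eigenspace_iff]
    have h2 : t • N v = -v := by rw [← add_eq_zero_iff_eq_neg, add_comm, h1]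
    rw [neg_smul, ← smul_neg, ← h2, inv_smul_smul₀ ht0]
  calc finrank K (LinearMap.range S) = finrank K (LinearMap.range ((S + t • T) ∘ₗ R)) :=
        (LinearMap.finrank_range_of_inj hinj).symm
    _ ≤ _ := Submodule.finrank_mono (LinearMap.range_comp_le_range _ _)

/-- A subset `U` of a subspace `L` is line-open if every line in `L` that meets `U` lies in `U` up
to finitely many points. Nonempty Zariski open sets have this property, which is all that is
needed to choose general elements. -/
def IsLineOpen (L : Submodule K E) (U : Set E) : Prop :=
  U ⊆ L ∧ ∀ p ∈ U, ∀ q ∈ L, {t : K | p + t • (q - p) ∉ U}.Finite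

theorem IsLineOpen.inter {L : Submodule K E} {U U' : Set E} (hU : IsLineOpen L U)
    (hU' : IsLineOpen L U') : IsLineOpen L (U ∩ U') := by
  refine ⟨fun x hx => hU.1 hx.1, fun p hp q hq => ?_⟩
  refine ((hU.2 p hp.1 q hq).union (hU'.2 p hp.2 q hq)).subset fun t ht => ?_
  by_contra hc
  simp only [Set.mem_union, Set.mem_ofPred_eq, not_or, not_not] at hc
  exact ht hc

theorem IsLineOpen.inter_nonempty [Infinite K] {L : Submodule K E} {U U' : Set E}
    (hU : IsLineOpen L U) (hU' : IsLineOpen L U') (h : U.Nonempty) (h' : U'.Nonempty) :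
    (U ∩ U').Nonempty := by
  obtain ⟨p, hp⟩ := h
  obtain ⟨q, hq⟩ := h'
  have h1 := hU.2 p hp q (hU'.1 hq)
  have h2 := (hU'.2 q hq p (hU.1 hp)).image fun t => 1 - t
  obtain ⟨t, ht⟩ := (h1.union h2).infinite_compl.nonempty
  simp only [Set.mem_compl_iff, Set.mem_union, Set.mem_ofPred_eq, not_or, not_not] at ht
  refine ⟨p + t • (q - p), ht.1, ?_⟩
  by_contra hc
  refine ht.2 ⟨1 - t, ?_, by ring⟩
  simp only [Set.mem_ofPred_eq]
  convert hc using 2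
  module

end LineOpen

section Green

variable {K : Type*} [Field K] {B : Type*} [CommRing B] [Algebra K B]

/-- The subspace `ℓ · N`. -/
abbrev mulSub (ℓ : B) (N : Submodule K B) : Submodule K B := N.map (LinearMap.mulLeft K ℓ)

/-- The elements `ℓ` of `L` for which `W + ℓ N` has the largest possible dimension. -/
def generalElements (L N W : Submodule K B) : Set B :=
  {ℓ | ℓ ∈ L ∧ ∀ ℓ' ∈ L, finrank K ↥(W ⊔ mulSub ℓ' N) ≤ finrank K ↥(W ⊔ mulSub ℓ N)}

theorem finrank_sup_mulSub_le (N W : Submodule K B) [FiniteDimensional K N]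
    [FiniteDimensional K W] (ℓ : B) :
    finrank K ↥(W ⊔ mulSub ℓ N) ≤ finrank K W + finrank K N :=
  (Submodule.finrank_add_le_finrank_add_finrank _ _).trans
    (Nat.add_le_add_left (Submodule.finrank_map_le _ _) _)

theorem generalElements_nonempty (L N W : Submodule K B) [FiniteDimensional K N]
    [FiniteDimensional K W] : (generalElements L N W).Nonempty := by
  have hb : ∃ n, ∀ m ∈ {m | ∃ ℓ ∈ L, finrank K ↥(W ⊔ mulSub ℓ N) = m}, m ≤ n :=
    ⟨_, by rintro _ ⟨ℓ, -, rfl⟩; exact finrank_sup_mulSub_le N W ℓ⟩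
  have hne : {m | ∃ ℓ ∈ L, finrank K ↥(W ⊔ mulSub ℓ N) = m}.Nonempty := ⟨_, 0, L.zero_mem, rfl⟩
  obtain ⟨ℓ, hℓ, h⟩ := Nat.sSup_mem hne hb
  exact ⟨ℓ, hℓ, fun ℓ' hℓ' => h ▸ le_csSup hb ⟨ℓ', hℓ', rfl⟩⟩

theorem isLineOpen_generalElements (L N W : Submodule K B) [FiniteDimensional K N]
    [FiniteDimensional K W] : IsLineOpen L (generalElements L N W) := by
  refine ⟨fun x hx => hx.1, fun p hp q hq => ?_⟩
  have hr : ∀ ℓ : B, LinearMap.range (W.subtype.coprod (LinearMap.mulLeft K ℓ ∘ₗ N.subtype)) =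
      W ⊔ mulSub ℓ N := fun ℓ => by
    rw [LinearMap.range_coprod, Submodule.range_subtype, LinearMap.range_comp,
      Submodule.range_subtype]
  refine (finite_setOf_finrank_range_add_smul_lt
    (W.subtype.coprod (LinearMap.mulLeft K p ∘ₗ N.subtype))
    ((0 : W →ₗ[K] B).coprod (LinearMap.mulLeft K (q - p) ∘ₗ N.subtype))).subset fun t ht => ?_
  have hadd : W.subtype.coprod (LinearMap.mulLeft K p ∘ₗ N.subtype) +
      t • (0 : W →ₗ[K] B).coprod (LinearMap.mulLeft K (q - p) ∘ₗ N.subtype) =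
      W.subtype.coprod (LinearMap.mulLeft K (p + t • (q - p)) ∘ₗ N.subtype) := by
    ext x
    · simp
    · simp [add_mul]
  rw [Set.mem_ofPred_eq, hadd, hr, hr]
  by_contra hc
  refine ht ⟨L.add_mem hp.1 (L.smul_mem _ (L.sub_mem hq hp.1)), fun ℓ' hℓ' => ?_⟩
  exact (hp.2 ℓ' hℓ').trans (not_lt.1 hc)

/-- The colon space `{f ∈ N : ℓ f ∈ W}`. -/
abbrev colonSub (N W : Submodule K B) (ℓ : B) : Submodule K B :=
  N ⊓ W.comap (LinearMap.mulLeft K ℓ)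

theorem finrank_map_add_finrank_inf_ker {V E : Type*} [AddCommGroup V] [Module K V]
    [AddCommGroup E] [Module K E] (f : V →ₗ[K] E) (N : Submodule K V) [FiniteDimensional K N] :
    finrank K (N.map f) + finrank K ↥(N ⊓ LinearMap.ker f) = finrank K N := by
  have h := LinearMap.finrank_range_add_finrank_ker (f ∘ₗ N.subtype)
  rw [LinearMap.range_comp, Submodule.range_subtype, LinearMap.ker_comp] at h
  rw [← h]
  congr 1
  rw [← Submodule.map_comap_subtype]
  exact (Submodule.equivMapOfInjective _ N.subtype_injective _).finrank_eq.symm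

/-- The exact sequence `0 → N / (W : ℓ) → M / W → M / (W + ℓ N) → 0`, as a dimension count. -/
theorem finrank_sup_mulSub_add_finrank_colonSub (N W : Submodule K B) [FiniteDimensional K N]
    [FiniteDimensional K W] (ℓ : B) :
    finrank K ↥(W ⊔ mulSub ℓ N) + finrank K (colonSub N W ℓ) = finrank K W + finrank K N := by
  have h1 := Submodule.finrank_sup_add_finrank_inf_eq W (mulSub ℓ N)
  have h2 : finrank K (mulSub ℓ N) + _ = _ :=
    finrank_map_add_finrank_inf_ker (LinearMap.mulLeft K ℓ) N
  have h3 := finrank_map_add_finrank_inf_ker (LinearMap.mulLeft K ℓ) (colonSub N W ℓ)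
  have h4 : (colonSub N W ℓ).map (LinearMap.mulLeft K ℓ) = W ⊓ mulSub ℓ N := by
    rw [← Submodule.map_inf_eq_map_inf_comap, inf_comm]
  have h5 : colonSub N W ℓ ⊓ LinearMap.ker (LinearMap.mulLeft K ℓ) =
      N ⊓ LinearMap.ker (LinearMap.mulLeft K ℓ) := by
    refine le_antisymm (inf_le_inf_right _ inf_le_left) fun x hx => ⟨⟨hx.1, ?_⟩, hx.2⟩
    change LinearMap.mulLeft K ℓ x ∈ W
    rw [LinearMap.mem_ker.1 hx.2]
    exact W.zero_mem
  rw [h4, h5] at h3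
  omega

end Green

/-! ### Green's and Macaulay's theorems -/

section Green

variable {K : Type*} [Field K] {B : Type*} [CommRing B] [Algebra K B]

theorem finiteDimensional_pow (L : Submodule K B) [FiniteDimensional K L] (d : ℕ) :
    FiniteDimensional K ↥(L ^ d) :=
  Module.Finite.iff_fg.2 ((Module.Finite.iff_fg.1 ‹_›).pow d)

theorem mulSub_pow_le {L : Submodule K B} {ℓ : B} (hℓ : ℓ ∈ L) (d : ℕ) :
    mulSub ℓ (L ^ d) ≤ L ^ (d + 1) := by
  rw [pow_succ']
  rintro _ ⟨x, hx, rfl⟩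
  exact Submodule.mul_mem_mul hℓ hx

/-- The codimension in `M` of a subspace `W` of `M`. -/
noncomputable def codimIn (M W : Submodule K B) : ℕ := finrank K M - finrank K W

theorem codimIn_add_finrank {M W : Submodule K B} [FiniteDimensional K M] (h : W ≤ M) :
    codimIn M W + finrank K W = finrank K M :=
  Nat.sub_add_cancel (Submodule.finrank_mono h)

/-- Adding `ℓ L ^ d` for general `ℓ` properly enlarges a proper subspace of `L ^ (d + 1)`. -/
theorem finrank_lt_finrank_sup_mulSub {L : Submodule K B} [FiniteDimensional K L] {d : ℕ}
    {W : Submodule K B} (hW : W < L ^ (d + 1)) {ℓ : B} (hℓ : ℓ ∈ generalElements L (L ^ d) W) :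
    finrank K W < finrank K ↥(W ⊔ mulSub ℓ (L ^ d)) := by
  have := finiteDimensional_pow L d
  have := finiteDimensional_pow L (d + 1)
  have : FiniteDimensional K W := Submodule.finiteDimensional_of_le hW.le
  obtain ⟨ℓ', hℓ', h⟩ : ∃ ℓ' ∈ L, ¬ mulSub ℓ' (L ^ d) ≤ W := by
    by_contra hc
    push Not at hc
    refine hW.not_ge ?_
    rw [pow_succ', Submodule.mul_le]
    exact fun m hm n hn => hc m hm ⟨n, hn, rfl⟩
  exact (Submodule.finrank_lt_finrank_of_lt (left_lt_sup.2 h)).trans_le (hℓ.2 ℓ' hℓ')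

/-- **Green's hyperplane restriction theorem**: for a subspace `W` of codimension `c` in
`L ^ (d + 1)` and a general `ℓ ∈ L`, the codimension of `W + ℓ L ^ d` is at most
`c_{⟨d + 1⟩}`. -/
theorem codimIn_sup_mulSub_le_greenBound [Infinite K] (L : Submodule K B) [FiniteDimensional K L]
    (d : ℕ) (W : Submodule K B) (hW : W ≤ L ^ (d + 1)) (ℓ : B)
    (hℓ : ℓ ∈ generalElements L (L ^ d) W) :
    codimIn (L ^ (d + 1)) (W ⊔ mulSub ℓ (L ^ d)) ≤
      greenBound (d + 1) (codimIn (L ^ (d + 1)) W) := by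
  have hfin := finiteDimensional_pow L
  induction d generalizing W ℓ with
  | zero =>
    rw [greenBound_one]
    have h1 := codimIn_add_finrank hW
    have h2 := codimIn_add_finrank (sup_le hW (mulSub_pow_le hℓ.1 0))
    rcases hW.eq_or_lt with heq | hlt
    · have : FiniteDimensional K ↥(W ⊔ mulSub ℓ (L ^ 0)) :=
        Submodule.finiteDimensional_of_le (sup_le hW (mulSub_pow_le hℓ.1 0))
      have := Submodule.finrank_mono (le_sup_left.trans' heq.ge :
        L ^ (0 + 1) ≤ W ⊔ mulSub ℓ (L ^ 0))
      omega
    · have := finrank_lt_finrank_sup_mulSub hlt hℓ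
      omega
  | succ d ih =>
    obtain ⟨c, hc⟩ : ∃ c, codimIn (L ^ (d + 1 + 1)) W = c := ⟨_, rfl⟩
    induction c using Nat.strong_induction_on generalizing W ℓ with
    | _ c ihc =>
    have : FiniteDimensional K W := Submodule.finiteDimensional_of_le hW
    rcases hW.eq_or_lt with heq | hlt
    · have h1 := codimIn_add_finrank (sup_le hW (mulSub_pow_le hℓ.1 (d + 1)))
      have h2 := Submodule.finrank_mono (le_sup_left.trans' heq.ge :
        L ^ (d + 1 + 1) ≤ W ⊔ mulSub ℓ (L ^ (d + 1)))
      have h3 : codimIn (L ^ (d + 1 + 1)) (W ⊔ mulSub ℓ (L ^ (d + 1))) = 0 := by omega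
      rw [h3]
      exact Nat.zero_le _
    set W₁ := W ⊔ mulSub ℓ (L ^ (d + 1)) with hW₁
    set W₂ := colonSub (L ^ (d + 1)) W ℓ with hW₂
    have hW₁le : W₁ ≤ L ^ (d + 1 + 1) := sup_le hW (mulSub_pow_le hℓ.1 _)
    have hW₂le : W₂ ≤ L ^ (d + 1) := inf_le_left
    have : FiniteDimensional K W₂ := Submodule.finiteDimensional_of_le hW₂le
    have hdrop : finrank K W < finrank K W₁ := finrank_lt_finrank_sup_mulSub hlt hℓ
    -- a second linear form, general with respect to `W`, its restriction and its colon space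
    obtain ⟨g, ⟨hgW, hgW₁⟩, hgW₂⟩ : ((generalElements L (L ^ (d + 1)) W ∩
        generalElements L (L ^ (d + 1)) W₁) ∩ generalElements L (L ^ d) W₂).Nonempty := by
      have o := isLineOpen_generalElements L (L ^ (d + 1)) W
      have o₁ := isLineOpen_generalElements L (L ^ (d + 1)) W₁
      have o₂ := isLineOpen_generalElements L (L ^ d) W₂
      exact (o.inter o₁).inter_nonempty o₂ (o.inter_nonempty o₁ (generalElements_nonempty _ _ _)
        (generalElements_nonempty _ _ _)) (generalElements_nonempty _ _ _)
    set W₃ := W ⊔ mulSub g (L ^ (d + 1)) with hW₃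
    have hW₃le : W₃ ≤ L ^ (d + 1 + 1) := sup_le hW (mulSub_pow_le hgW.1 _)
    have e₁ : finrank K W₁ + finrank K W₂ = finrank K W + finrank K ↥(L ^ (d + 1)) :=
      finrank_sup_mulSub_add_finrank_colonSub (L ^ (d + 1)) W ℓ
    have e₃ : finrank K ↥(W₃ ⊔ mulSub ℓ (L ^ (d + 1))) + finrank K (colonSub (L ^ (d + 1)) W₃ ℓ) =
        finrank K W₃ + finrank K ↥(L ^ (d + 1)) :=
      finrank_sup_mulSub_add_finrank_colonSub (L ^ (d + 1)) W₃ ℓ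
    have heq : finrank K W₃ = finrank K W₁ := le_antisymm (hℓ.2 g hgW.1) (hgW.2 ℓ hℓ.1)
    have hcomm : W₃ ⊔ mulSub ℓ (L ^ (d + 1)) = W₁ ⊔ mulSub g (L ^ (d + 1)) := by
      rw [hW₃, hW₁, sup_right_comm]
    have hcolon : W₂ ⊔ mulSub g (L ^ d) ≤ colonSub (L ^ (d + 1)) W₃ ℓ := by
      refine sup_le (inf_le_inf_left _ (Submodule.comap_mono le_sup_left))
        (le_inf (mulSub_pow_le hgW.1 _) ?_)
      rintro _ ⟨x, hx, rfl⟩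
      refine le_sup_right (a := W) (?_ : ℓ * (g * x) ∈ mulSub g (L ^ (d + 1)))
      rw [mul_left_comm]
      refine ⟨ℓ * x, ?_, rfl⟩
      rw [pow_succ']
      exact Submodule.mul_mem_mul hℓ.1 hx
    have c₀ := codimIn_add_finrank hW
    have c₁ := codimIn_add_finrank hW₁le
    have c₂ := codimIn_add_finrank hW₂le
    have c₃ := codimIn_add_finrank (sup_le hW₁le (mulSub_pow_le hgW.1 (d + 1)))
    have c₄ := codimIn_add_finrank (sup_le hW₂le (mulSub_pow_le hgW.1 d))
    have i₁ := ihc (codimIn (L ^ (d + 1 + 1)) W₁) (by omega) W₁ hW₁le g hgW₁ rfl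
    have i₂ := ih W₂ hW₂le g hgW₂
    have m₂ := Submodule.finrank_mono hcolon
    rw [hcomm] at e₃
    refine (le_greenBound_add (d := d + 1) (a := codimIn (L ^ (d + 1)) W₂)
      (b := codimIn (L ^ (d + 1 + 1)) W₁) (by omega)).trans_eq (congrArg _ (by omega))

/-- **Macaulay's theorem** for the quotient by `ℓ`: with `c_i` the dimension of
`L ^ i / ℓ L ^ (i - 1)`, one has `c_{i + 1} ≤ c_i + (c_{i + 1})_{⟨i + 1⟩}`. -/
theorem codimIn_mulSub_sub_greenBound_le [Infinite K] (L : Submodule K B) [FiniteDimensional K L]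
    {ℓ : B} (hℓ : ℓ ∈ L) (d : ℕ) :
    codimIn (L ^ (d + 2)) (mulSub ℓ (L ^ (d + 1))) -
      greenBound (d + 2) (codimIn (L ^ (d + 2)) (mulSub ℓ (L ^ (d + 1)))) ≤
      codimIn (L ^ (d + 1)) (mulSub ℓ (L ^ d)) := by
  have hfin := finiteDimensional_pow L
  set W := mulSub ℓ (L ^ (d + 1)) with hW
  obtain ⟨g, hg⟩ := generalElements_nonempty L (L ^ (d + 1)) W
  have h1 := codimIn_sup_mulSub_le_greenBound L (d + 1) W (mulSub_pow_le hℓ _) g hg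
  have h2 : finrank K ↥(W ⊔ mulSub g (L ^ (d + 1))) + finrank K (colonSub (L ^ (d + 1)) W g) =
      finrank K W + finrank K ↥(L ^ (d + 1)) :=
    finrank_sup_mulSub_add_finrank_colonSub (L ^ (d + 1)) W g
  have h3 : mulSub ℓ (L ^ d) ≤ colonSub (L ^ (d + 1)) W g := by
    refine le_inf (mulSub_pow_le hℓ _) ?_
    rintro _ ⟨x, hx, rfl⟩
    refine (?_ : g * (ℓ * x) ∈ W)
    rw [mul_left_comm]
    refine ⟨g * x, ?_, rfl⟩
    rw [pow_succ']
    exact Submodule.mul_mem_mul hg.1 hx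
  have h4 := Submodule.finrank_mono h3
  have h5 := codimIn_add_finrank (sup_le (mulSub_pow_le hℓ (d + 1)) (mulSub_pow_le hg.1 (d + 1)))
  have h6 := codimIn_add_finrank (mulSub_pow_le hℓ (d + 1))
  have h7 := codimIn_add_finrank (mulSub_pow_le hℓ d)
  rw [← hW] at h5 h6
  rw [show d + 2 = d + 1 + 1 from rfl]
  omega

end Green

/-! ### The bound over an infinite field -/

section Duality

variable {K : Type*} [Field K] {B : Type*} [CommRing B] [Algebra K B]

/-- The pairing `B × M → K`, `(f, y) ↦ φ (f y)`, attached to a linear functional `φ`. -/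
noncomputable def functionalPairing (φ : B →ₗ[K] K) (M : Submodule K B) : B →ₗ[K] Dual K M :=
  ((LinearMap.mul K B).compr₂ φ).compl₂ M.subtype

theorem functionalPairing_apply (φ : B →ₗ[K] K) (M : Submodule K B) (f : B) (y : M) :
    functionalPairing φ M f y = φ (f * y) := rfl

theorem finrank_le_of_pairing (φ : B →ₗ[K] K) (N M : Submodule K B) [FiniteDimensional K N]
    [FiniteDimensional K M] (h : ∀ u ∈ N, (∀ y ∈ M, φ (u * y) = 0) → u = 0) :
    finrank K N ≤ finrank K M := by
  rw [← Subspace.dual_finrank_eq (V := M)]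
  refine LinearMap.finrank_le_finrank_of_injective (f := functionalPairing φ M ∘ₗ N.subtype) ?_
  rw [← LinearMap.ker_eq_bot, LinearMap.ker_eq_bot']
  intro u hu
  exact Subtype.ext (h u u.2 fun y hy => LinearMap.congr_fun hu ⟨y, hy⟩)

/-- If `φ (u x)` is nondegenerate in `u ∈ L ^ (n + 1)` for `x ∈ L`, then multiplication by `ℓ` on
`L ^ n` is dual to a restriction of multiplication by `ℓ` on `L`. -/
theorem finrank_mulSub_pow_le (φ : B →ₗ[K] K) (L : Submodule K B) [FiniteDimensional K L] (n : ℕ)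
    (h : ∀ u ∈ L ^ (n + 1), (∀ x ∈ L, φ (u * x) = 0) → u = 0) {ℓ : B} (hℓ : ℓ ∈ L) :
    finrank K (mulSub ℓ (L ^ n)) ≤ finrank K (mulSub ℓ L) := by
  have := finiteDimensional_pow L n
  have h1 : finrank K (mulSub ℓ (L ^ n)) + _ = _ :=
    finrank_map_add_finrank_inf_ker (LinearMap.mulLeft K ℓ) (L ^ n)
  have h2 := finrank_map_add_finrank_inf_ker (functionalPairing φ (mulSub ℓ L)) (L ^ n)
  have h3 : L ^ n ⊓ LinearMap.ker (functionalPairing φ (mulSub ℓ L)) ≤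
      L ^ n ⊓ LinearMap.ker (LinearMap.mulLeft K ℓ) := by
    refine le_inf inf_le_left fun f hf => ?_
    refine h _ (mulSub_pow_le hℓ n ⟨f, hf.1, rfl⟩) fun x hx => ?_
    have := LinearMap.congr_fun hf.2 ⟨ℓ * x, x, hx, rfl⟩
    rw [functionalPairing_apply] at this
    simpa [mul_assoc, mul_left_comm] using this
  have h4 := Submodule.finrank_mono h3
  have h5 : finrank K ((L ^ n).map (functionalPairing φ (mulSub ℓ L))) ≤
      finrank K (Dual K (mulSub ℓ L)) := Submodule.finrank_le _
  rw [Subspace.dual_finrank_eq] at h5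
  omega

/-- Macaulay's theorem iterated from degree `s + 2` down to degree `2`. -/
theorem macaulayDescent_codimIn_le [Infinite K] (L : Submodule K B) [FiniteDimensional K L]
    {ℓ : B} (hℓ : ℓ ∈ L) (s : ℕ) :
    macaulayDescent s (codimIn (L ^ (s + 2)) (mulSub ℓ (L ^ (s + 1)))) ≤
      codimIn (L ^ 2) (mulSub ℓ (L ^ 1)) := by
  induction s with
  | zero => exact le_rfl
  | succ s ih =>
    exact (macaulayDescent_mono s (codimIn_mulSub_sub_greenBound_le L hℓ (s + 1))).trans ih

/-- The lower bound for the degree two entry over an infinite field, for socle degree `s + 4`. -/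
theorem sub_greenBound_add_le_finrank_sq [Infinite K] (φ : B →ₗ[K] K) (L : Submodule K B)
    [FiniteDimensional K L] (s : ℕ)
    (h : ∀ u ∈ L ^ (s + 3), (∀ x ∈ L, φ (u * x) = 0) → u = 0)
    (hr : finrank K ↥(L ^ (s + 3)) = finrank K L) :
    finrank K L - greenBound (s + 3) (finrank K L) +
      macaulayDescent (s + 1) (greenBound (s + 3) (finrank K L)) ≤ finrank K ↥(L ^ 2) := by
  have hfin := finiteDimensional_pow L
  obtain ⟨ℓ, hℓ⟩ := generalElements_nonempty L (L ^ (s + 2)) ⊥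
  have h1 := codimIn_sup_mulSub_le_greenBound L (s + 2) ⊥ bot_le ℓ hℓ
  have h2 := macaulayDescent_codimIn_le L hℓ.1 (s + 1)
  have h3 := finrank_mulSub_pow_le φ L (s + 2) h hℓ.1
  have h4 := codimIn_add_finrank (mulSub_pow_le hℓ.1 (s + 2))
  have h5 := codimIn_add_finrank (mulSub_pow_le hℓ.1 1)
  have h6 : codimIn (L ^ (s + 2 + 1)) ⊥ = finrank K L := by
    rw [codimIn, finrank_bot, Nat.sub_zero, ← hr]
  rw [bot_sup_eq, h6] at h1
  have h7 := macaulayDescent_le_add (s + 1) h1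
  have h8 := greenBound_le (s + 3) (finrank K L)
  rw [show s + 1 + 2 = s + 2 + 1 by omega, show s + 1 + 1 = s + 2 by omega] at h2
  rw [show s + 2 + 1 = s + 3 from rfl] at *
  rw [pow_one] at h2 h5
  rw [show 1 + 1 = 2 from rfl] at h5
  omega

end Duality

/-! ### Extension of scalars -/

section BaseChange

variable {k : Type*} [Field k] (K : Type*) [Field K] [Algebra k K] {A : Type*} [CommRing A]
  [Algebra k A]

theorem baseChange_mul_submodule (M N : Submodule k A) :
    (M * N).baseChange K = M.baseChange K * N.baseChange K := by
  refine le_antisymm ?_ ?_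
  · rw [Submodule.baseChange_eq_span, Submodule.span_le]
    rintro _ ⟨x, hx, rfl⟩
    change (1 : K) ⊗ₜ[k] x ∈ _
    induction hx using Submodule.mul_induction_on' with
    | mem_mul_mem m hm n hn =>
      have := Submodule.mul_mem_mul (Submodule.tmul_mem_baseChange_of_mem (1 : K) hm)
        (Submodule.tmul_mem_baseChange_of_mem (1 : K) hn)
      simpa using this
    | add x _ y _ hx hy =>
      rw [TensorProduct.tmul_add]
      exact add_mem hx hy
  · rw [Submodule.baseChange_eq_span, Submodule.baseChange_eq_span, Submodule.span_mul_span,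
      Submodule.span_le]
    rintro _ ⟨_, ⟨m, hm, rfl⟩, _, ⟨n, hn, rfl⟩, rfl⟩
    have := Submodule.tmul_mem_baseChange_of_mem (1 : K) (Submodule.mul_mem_mul hm hn)
    simpa using this

theorem baseChange_pow_submodule (L : Submodule k A) (n : ℕ) :
    (L ^ (n + 1)).baseChange K = L.baseChange K ^ (n + 1) := by
  induction n with
  | zero => simp
  | succ n ih => rw [pow_succ, baseChange_mul_submodule, ih, ← pow_succ]

theorem finrank_baseChange_submodule (L : Submodule k A) :
    finrank K (L.baseChange K) = finrank k L := by
  rw [← (Submodule.toBaseChange.toLinearEquiv K L).finrank_eq, Module.finrank_baseChange]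

/-- Nondegeneracy of the pairing given by a functional survives extension of scalars. -/
theorem eq_zero_of_baseChange_pairing (φ : A →ₗ[k] k) (M L : Submodule k A)
    (h : ∀ u ∈ M, (∀ x ∈ L, φ (u * x) = 0) → u = 0) (u : K ⊗[k] A) (hu : u ∈ M.baseChange K)
    (hu0 : ∀ x ∈ L.baseChange K,
      (AlgebraTensorModule.rid k K K).toLinearMap.comp (φ.baseChange K) (u * x) = 0) : u = 0 := by
  obtain ⟨v, rfl⟩ := Submodule.toBaseChange_surjective' K M hu
  let b := Basis.ofVectorSpace k K
  obtain ⟨c, rfl⟩ := TensorProduct.eq_repr_basis_left b v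
  have hc : ∀ i, c i = 0 := fun i => by
    refine Subtype.ext (h _ (c i).2 fun x hx => ?_)
    have h1 := hu0 _ (Submodule.tmul_mem_baseChange_of_mem (1 : K) hx)
    have h2 : c.sum (fun i m => φ ((m : A) * x) • b i) = 0 := by
      simpa [Finsupp.sum, Finset.sum_mul] using h1
    by_cases hi : i ∈ c.support
    · exact linearIndependent_iff'.1 b.linearIndependent c.support _ h2 i hi
    · rw [Finsupp.notMem_support_iff.1 hi]
      simp
  have hc0 : c = 0 := Finsupp.ext hc
  simp [hc0]

/-- The lower bound for the degree two entry over an arbitrary field. -/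
theorem sub_greenBound_add_le_finrank_sq_of_field (φ : A →ₗ[k] k) (L : Submodule k A)
    [FiniteDimensional k L] (s : ℕ)
    (h : ∀ u ∈ L ^ (s + 3), (∀ x ∈ L, φ (u * x) = 0) → u = 0)
    (hr : finrank k ↥(L ^ (s + 3)) = finrank k L) :
    finrank k L - greenBound (s + 3) (finrank k L) +
      macaulayDescent (s + 1) (greenBound (s + 3) (finrank k L)) ≤ finrank k ↥(L ^ 2) := by
  let K := AlgebraicClosure k
  have : FiniteDimensional K (L.baseChange K) :=
    Module.Finite.equiv (Submodule.toBaseChange.toLinearEquiv K L)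
  have h1 := sub_greenBound_add_le_finrank_sq
    ((AlgebraTensorModule.rid k K K).toLinearMap.comp (φ.baseChange K)) (L.baseChange K) s
    (by
      rw [← baseChange_pow_submodule]
      exact eq_zero_of_baseChange_pairing K φ _ _ h)
    (by rw [← baseChange_pow_submodule, finrank_baseChange_submodule,
      finrank_baseChange_submodule, hr])
  rwa [← baseChange_pow_submodule K L 1, finrank_baseChange_submodule,
    finrank_baseChange_submodule] at h1

end BaseChange

/-! ### Duality in artinian Gorenstein algebras -/

section Gorenstein

variable {k : Type u} [Field k] {A : Type u} [CommRing A] [Algebra k A]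
  {𝒜 : ℕ → Submodule k A} [GradedAlgebra 𝒜]

/-- The homogeneous components of a standard graded algebra are the powers of `A_1`, so that results
on powers of a subspace apply to them. -/
theorem IsStandardGraded.pow_one_eq (h : IsStandardGraded 𝒜) (i : ℕ) : 𝒜 1 ^ i = 𝒜 i := by
  have hle : ∀ i, 𝒜 1 ^ i ≤ 𝒜 i := fun i => by
    induction i with
    | zero => rw [pow_zero, h.zero_eq]
    | succ i ih =>
      rw [pow_succ, Submodule.mul_le]
      exact fun m hm n hn => SetLike.mul_mem_graded (ih hm) hn
  have htop : ∀ a : A, a ∈ ⨆ i, 𝒜 1 ^ i := fun a => by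
    have ha : a ∈ Algebra.adjoin k (𝒜 1 : Set A) := h.adjoin_one ▸ Algebra.mem_top
    induction ha using Algebra.adjoin_induction with
    | mem x hx => exact Submodule.mem_iSup_of_mem 1 (by rwa [pow_one])
    | algebraMap c =>
      exact Submodule.mem_iSup_of_mem 0 (by rw [pow_zero]; exact Submodule.algebraMap_mem c)
    | add x y _ _ hx hy => exact add_mem hx hy
    | mul x y _ _ hx hy =>
      have hxy := Submodule.mul_mem_mul hx hy
      rw [Submodule.iSup_mul] at hxy
      refine (iSup_le fun i => ?_ : (⨆ i, 𝒜 1 ^ i * ⨆ j, 𝒜 1 ^ j) ≤ _) hxy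
      rw [Submodule.mul_iSup]
      exact iSup_le fun j => by
        rw [← pow_add]
        exact le_iSup (fun i => 𝒜 1 ^ i) (i + j)
  refine le_antisymm (hle i) fun a ha => ?_
  have key : ∀ b ∈ ⨆ i, 𝒜 1 ^ i, (DirectSum.decompose 𝒜 b i : A) ∈ 𝒜 1 ^ i := fun b hb => by
    refine Submodule.iSup_induction (fun i => 𝒜 1 ^ i)
      (motive := fun b => (DirectSum.decompose 𝒜 b i : A) ∈ 𝒜 1 ^ i) hb (fun j x hx => ?_) ?_ ?_
    · by_cases hij : j = i
      · subst hij
        rwa [DirectSum.decompose_of_mem_same 𝒜 (hle j hx)]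
      · rw [DirectSum.decompose_of_mem_ne 𝒜 (hle j hx) hij]
        exact zero_mem _
    · simp
    · intro x y hx hy
      rw [DirectSum.decompose_add]
      exact add_mem hx hy
  have := key a (htop a)
  rwa [DirectSum.decompose_of_mem_same 𝒜 ha] at this

theorem IsStandardGraded.finiteDimensional (h : IsStandardGraded 𝒜) (i : ℕ) :
    FiniteDimensional k (𝒜 i) := by
  have := h.finite_one
  rw [← h.pow_one_eq i]
  exact finiteDimensional_pow _ i

/-- In an artinian Gorenstein algebra with socle degree `e` the socle is `A_e`. -/
theorem IsArtinianGorenstein.socle_eq (h : IsArtinianGorenstein 𝒜) {e : ℕ} (he : 𝒜 e ≠ ⊥)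
    (htop : ∀ i, e < i → 𝒜 i = ⊥) : gradedSocle 𝒜 = 𝒜 e := by
  have hs : FiniteDimensional k (gradedSocle 𝒜) :=
    FiniteDimensional.of_finrank_pos (by rw [h.socle]; exact one_pos)
  have hle : 𝒜 e ≤ gradedSocle 𝒜 := fun a ha i hi x hx => by
    have : x * a ∈ 𝒜 (i + e) := SetLike.mul_mem_graded hx ha
    rwa [htop _ (by omega), Submodule.mem_bot] at this
  have := h.standard.finiteDimensional e
  refine (Submodule.eq_of_le_of_finrank_le hle ?_).symm
  rw [h.socle]
  exact Nat.one_le_iff_ne_zero.2 fun h0 => he (Submodule.finrank_eq_zero.1 h0)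

/-- A nonzero element of degree `i < e` is not in the socle, so some linear form does not kill it;
iterating, some form of degree `e - i` does not kill it. -/
theorem IsArtinianGorenstein.exists_mul_ne_zero (h : IsArtinianGorenstein 𝒜) {e : ℕ}
    (he : 𝒜 e ≠ ⊥) (htop : ∀ i, e < i → 𝒜 i = ⊥) (n i : ℕ) (hn : i + n = e) (u : A)
    (hu : u ∈ 𝒜 i) (hu0 : u ≠ 0) : ∃ y ∈ 𝒜 n, u * y ≠ 0 := by
  induction n generalizing i u with
  | zero => exact ⟨1, SetLike.GradedOne.one_mem, by rwa [mul_one]⟩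
  | succ n ih =>
    obtain ⟨x, hx, hx0⟩ : ∃ x ∈ 𝒜 1, x * u ≠ 0 := by
      by_contra hc
      push Not at hc
      have hsoc : u ∈ gradedSocle 𝒜 := fun j hj x hx => by
        obtain ⟨j, rfl⟩ : ∃ m, j = m + 1 := ⟨j - 1, by omega⟩
        rw [← h.standard.pow_one_eq, pow_succ] at hx
        induction hx using Submodule.mul_induction_on' with
        | mem_mul_mem m hm n hn => rw [mul_assoc, hc n hn, mul_zero]
        | add x _ y _ hx hy => rw [add_mul, hx, hy, add_zero]
      rw [h.socle_eq he htop] at hsoc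
      refine hu0 ?_
      rw [← DirectSum.decompose_of_mem_same 𝒜 hu]
      exact DirectSum.decompose_of_mem_ne 𝒜 hsoc (by omega)
    obtain ⟨y, hy, hxy⟩ := ih (i + 1) (by omega) (x * u)
      (by rw [add_comm]; exact SetLike.mul_mem_graded hx hu) hx0
    refine ⟨x * y, by rw [add_comm]; exact SetLike.mul_mem_graded hx hy, ?_⟩
    rwa [mul_left_comm, ← mul_assoc]

/-- An artinian Gorenstein algebra carries a linear functional that puts `A_i` and `A_{e - i}` into
duality. -/
theorem IsArtinianGorenstein.exists_functional (h : IsArtinianGorenstein 𝒜) {e : ℕ}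
    (he : 𝒜 e ≠ ⊥) (htop : ∀ i, e < i → 𝒜 i = ⊥) :
    ∃ φ : A →ₗ[k] k, ∀ i n, i + n = e → ∀ u ∈ 𝒜 i, (∀ y ∈ 𝒜 n, φ (u * y) = 0) → u = 0 := by
  obtain ⟨s, hs, hs0⟩ := Submodule.exists_mem_ne_zero_of_ne_bot he
  obtain ⟨φ, hφ⟩ : ∃ φ : Dual k A, φ s ≠ 0 := by
    by_contra hc
    push Not at hc
    exact hs0 ((Module.forall_dual_apply_eq_zero_iff k s).1 hc)
  refine ⟨φ, fun i n hin u hu hy => ?_⟩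
  by_contra hu0
  obtain ⟨y, hyn, huy⟩ := h.exists_mul_ne_zero he htop n i hin u hu hu0
  have hmem : u * y ∈ 𝒜 e := hin ▸ SetLike.mul_mem_graded hu hyn
  have h1 : finrank k (𝒜 e) = 1 := h.socle_eq he htop ▸ h.socle
  obtain ⟨c, hc⟩ := (finrank_eq_one_iff_of_nonzero' (⟨s, hs⟩ : 𝒜 e)
    (fun h0 => hs0 (congrArg Subtype.val h0))).1 h1 ⟨u * y, hmem⟩
  have hc' : c • s = u * y := congrArg Subtype.val hc
  have h2 := hy y hyn
  rw [← hc', map_smul, smul_eq_mul] at h2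
  refine huy ?_
  rw [← hc', (mul_eq_zero.1 h2).resolve_right hφ, zero_smul]

theorem IsArtinianGorenstein.le_finrank_two (h : IsArtinianGorenstein 𝒜) {s : ℕ}
    (he : 𝒜 (s + 4) ≠ ⊥) (htop : ∀ i, s + 4 < i → 𝒜 i = ⊥) (hr : 0 < finrank k (𝒜 1)) :
    binomialShift (finrank k (𝒜 1)) (s + 3) (-1) (-1) +
        binomialShift (finrank k (𝒜 1)) (s + 3) (-((s : ℤ) + 1)) (-((s : ℤ) + 2)) ≤
      finrank k (𝒜 2) := by
  obtain ⟨φ, hφ⟩ := h.exists_functional he htop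
  have hfin := h.standard.finiteDimensional
  refine (binomialShift_add_binomialShift_le hr).trans ?_
  rw [← h.standard.pow_one_eq 2]
  refine sub_greenBound_add_le_finrank_sq_of_field φ (𝒜 1) s ?_ ?_
  · rw [h.standard.pow_one_eq]
    exact hφ (s + 3) 1 (by omega)
  · rw [h.standard.pow_one_eq]
    exact le_antisymm (finrank_le_of_pairing φ _ _ (hφ (s + 3) 1 (by omega)))
      (finrank_le_of_pairing φ _ _ (hφ 1 (s + 3) (by omega)))

end Gorenstein

/-! ### Quotients of graded algebras by homogeneous ideals -/

section QuotientGrading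

variable {k : Type*} [Field k] {R : Type*} [CommRing R] [Algebra k R]
  (𝒢 : ℕ → Submodule k R) (I : Ideal R)

/-- The images in `R ⧸ I` of the homogeneous components of `R`. -/
def quotientGrading (i : ℕ) : Submodule k (R ⧸ I) := (𝒢 i).map (Ideal.Quotient.mkₐ k I).toLinearMap

theorem mk_mem_quotientGrading {i : ℕ} {x : R} (hx : x ∈ 𝒢 i) :
    Ideal.Quotient.mk I x ∈ quotientGrading 𝒢 I i := ⟨x, hx, rfl⟩

/-- The restriction of the quotient map to a homogeneous component. -/
def quotientGradingMk (i : ℕ) : 𝒢 i →ₗ[k] quotientGrading 𝒢 I i :=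
  (Ideal.Quotient.mkₐ k I).toLinearMap.restrict fun _ hx => mk_mem_quotientGrading 𝒢 I hx

variable {I} in
theorem apply_eq_of_mk_eq {N : Type*} [AddCommMonoid N] [Module k N] (f : R →ₗ[k] N)
    (hf : ∀ x ∈ I, f x = 0) {x y : R} (h : Ideal.Quotient.mk I x = Ideal.Quotient.mk I y) :
    f x = f y := by
  rw [← sub_add_cancel x y, map_add, hf _ (Ideal.Quotient.eq.1 h), zero_add]

/-- A linear map that vanishes on the ideal `I` factors through `R ⧸ I`. The target is only
assumed to be an additive monoid, so that direct sums can be used without change of instance. -/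
noncomputable def idealQuotientLift {N : Type*} [AddCommMonoid N] [Module k N] (f : R →ₗ[k] N)
    (hf : ∀ x ∈ I, f x = 0) : R ⧸ I →ₗ[k] N where
  toFun a := f (Function.surjInv Ideal.Quotient.mk_surjective a)
  map_add' a b := by
    rw [← map_add]
    exact apply_eq_of_mk_eq f hf (by simp only [map_add, Function.surjInv_eq])
  map_smul' c a := by
    rw [RingHom.id_apply, ← map_smul]
    refine apply_eq_of_mk_eq f hf ?_
    exact (Function.surjInv_eq Ideal.Quotient.mk_surjective (c • a)).trans
      ((congrArg (c • ·) (Function.surjInv_eq Ideal.Quotient.mk_surjective a).symm).trans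
        (map_smul (Ideal.Quotient.mkₐ k I) c _).symm)

theorem idealQuotientLift_mk {N : Type*} [AddCommMonoid N] [Module k N] (f : R →ₗ[k] N)
    (hf : ∀ x ∈ I, f x = 0) (x : R) :
    idealQuotientLift I f hf (Ideal.Quotient.mk I x) = f x :=
  apply_eq_of_mk_eq f hf (Function.surjInv_eq _ _)

variable [GradedAlgebra 𝒢]

/-- The decomposition of `R`, followed by the quotient map on each component. -/
noncomputable def decomposeMk : R →ₗ[k] DirectSum ℕ fun i => quotientGrading 𝒢 I i :=
  DirectSum.lmap (quotientGradingMk 𝒢 I) ∘ₗ (DirectSum.decomposeLinearEquiv 𝒢).toLinearMap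

theorem decomposeMk_eq_zero (hI : I.IsHomogeneous 𝒢) : ∀ x ∈ I, decomposeMk 𝒢 I x = 0 :=
  fun x hx => by
    ext i
    exact Ideal.Quotient.eq_zero_iff_mem.2 (hI i hx)

/-- The decomposition of `R ⧸ I` into the images of the homogeneous components of `R`. -/
noncomputable def quotientDecompose (hI : I.IsHomogeneous 𝒢) :
    R ⧸ I →ₗ[k] DirectSum ℕ fun i => quotientGrading 𝒢 I i :=
  idealQuotientLift I (decomposeMk 𝒢 I) (decomposeMk_eq_zero 𝒢 I hI)

theorem quotientDecompose_mk (hI : I.IsHomogeneous 𝒢) (x : R) :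
    quotientDecompose 𝒢 I hI (Ideal.Quotient.mk I x) =
      DirectSum.lmap (R := k) (quotientGradingMk 𝒢 I) (DirectSum.decompose 𝒢 x) :=
  idealQuotientLift_mk I _ _ x

theorem quotientDecompose_mk_of_mem (hI : I.IsHomogeneous 𝒢) {i : ℕ} {x : R} (hx : x ∈ 𝒢 i) :
    quotientDecompose 𝒢 I hI (Ideal.Quotient.mk I x) =
      DirectSum.lof k ℕ (fun i => quotientGrading 𝒢 I i) i
        ⟨Ideal.Quotient.mk I x, mk_mem_quotientGrading 𝒢 I hx⟩ := by
  rw [quotientDecompose_mk, DirectSum.decompose_of_mem 𝒢 hx, DirectSum.lmap_of]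
  rfl

/-- The quotient of a graded algebra by a homogeneous ideal is graded. -/
@[reducible] noncomputable def quotientGradedAlgebra (hI : I.IsHomogeneous 𝒢) :
    GradedAlgebra (quotientGrading 𝒢 I) where
  one_mem := ⟨1, SetLike.GradedOne.one_mem, rfl⟩
  mul_mem := by
    rintro i j _ _ ⟨x, hx, rfl⟩ ⟨y, hy, rfl⟩
    exact ⟨x * y, SetLike.mul_mem_graded hx hy, rfl⟩
  toDecomposition := DirectSum.Decomposition.ofLinearMap _ (quotientDecompose 𝒢 I hI)
    (by
      refine LinearMap.ext fun a => ?_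
      obtain ⟨x, rfl⟩ := Ideal.Quotient.mk_surjective a
      induction x using DirectSum.Decomposition.inductionOn 𝒢 with
      | zero => simp
      | homogeneous x =>
        rw [LinearMap.comp_apply, quotientDecompose_mk_of_mem 𝒢 I hI x.2,
          DirectSum.coeLinearMap_lof]
        rfl
      | add x y hx hy => rw [map_add, map_add, hx, hy, map_add])
    (by
      refine DirectSum.linearMap_ext _ fun i => LinearMap.ext ?_
      rintro ⟨_, x, hx, rfl⟩
      rw [LinearMap.comp_apply, LinearMap.comp_apply, DirectSum.coeLinearMap_lof]
      exact quotientDecompose_mk_of_mem 𝒢 I hI hx)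

end QuotientGrading

/-! ### Gorenstein algebras defined by a functional -/

section Apolar

variable {k : Type u} [Field k] {R : Type u} [CommRing R] [Algebra k R]

/-- The largest ideal contained in the kernel of the linear functional `φ`. -/
def apolarIdeal (φ : R →ₗ[k] k) : Ideal R where
  carrier := {f | ∀ g, φ (f * g) = 0}
  zero_mem' := fun g => by rw [zero_mul, map_zero]
  add_mem' := fun ha hb g => by rw [add_mul, map_add, ha, hb, add_zero]
  smul_mem' := fun c a ha g => by rw [smul_eq_mul, mul_comm c, mul_assoc, ha]

theorem mem_apolarIdeal {φ : R →ₗ[k] k} {f : R} : f ∈ apolarIdeal φ ↔ ∀ g, φ (f * g) = 0 := Iff.rfl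

variable {𝒢 : ℕ → Submodule k R} [GradedAlgebra 𝒢] {φ : R →ₗ[k] k} {e : ℕ}

theorem apply_decompose_eq (hφ : ∀ i, i ≠ e → ∀ x ∈ 𝒢 i, φ x = 0) (x : R) :
    φ (DirectSum.decompose 𝒢 x e) = φ x := by
  induction x using DirectSum.Decomposition.inductionOn 𝒢 with
  | zero => simp
  | @homogeneous i x =>
    by_cases hi : i = e
    · subst hi
      rw [DirectSum.decompose_of_mem_same 𝒢 x.2]
    · rw [DirectSum.decompose_of_mem_ne 𝒢 x.2 hi, hφ i hi x x.2, map_zero]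
  | add x y hx hy =>
    rw [DirectSum.decompose_add, DirectSum.add_apply, Submodule.coe_add, map_add, hx, hy, map_add]

theorem isHomogeneous_apolarIdeal (hφ : ∀ i, i ≠ e → ∀ x ∈ 𝒢 i, φ x = 0) :
    (apolarIdeal φ).IsHomogeneous 𝒢 := by
  intro i f hf
  refine mem_apolarIdeal.2 fun g => ?_
  induction g using DirectSum.Decomposition.inductionOn 𝒢 with
  | zero => simp
  | @homogeneous j g =>
    by_cases hij : i + j = e
    · rw [← DirectSum.coe_decompose_mul_add_of_right_mem 𝒢 g.2, hij, apply_decompose_eq hφ]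
      exact hf g
    · exact hφ _ hij _ (SetLike.mul_mem_graded (SetLike.coe_mem _) g.2)
  | add x y hx hy => rw [mul_add, map_add, hx, hy, add_zero]

theorem mem_apolarIdeal_of_lt (hφ : ∀ i, i ≠ e → ∀ x ∈ 𝒢 i, φ x = 0) {i : ℕ} (hi : e < i)
    {f : R} (hf : f ∈ 𝒢 i) : f ∈ apolarIdeal φ := by
  refine mem_apolarIdeal.2 fun g => ?_
  induction g using DirectSum.Decomposition.inductionOn 𝒢 with
  | zero => simp
  | @homogeneous j g => exact hφ (i + j) (by omega) _ (SetLike.mul_mem_graded hf g.2)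
  | add x y hx hy => rw [mul_add, map_add, hx, hy, add_zero]

theorem quotientGrading_apolarIdeal_eq_bot (hφ : ∀ i, i ≠ e → ∀ x ∈ 𝒢 i, φ x = 0) {i : ℕ}
    (hi : e < i) : quotientGrading 𝒢 (apolarIdeal φ) i = ⊥ := by
  rw [eq_bot_iff]
  rintro _ ⟨x, hx, rfl⟩
  exact Ideal.Quotient.eq_zero_iff_mem.2 (mem_apolarIdeal_of_lt hφ hi hx)

theorem exists_mem_notMem_apolarIdeal (hφ : ∀ i, i ≠ e → ∀ x ∈ 𝒢 i, φ x = 0) (hφ0 : φ ≠ 0) :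
    ∃ s ∈ 𝒢 e, φ s ≠ 0 ∧ s ∉ apolarIdeal φ := by
  obtain ⟨x, hx⟩ : ∃ x, φ x ≠ 0 := by
    by_contra hc
    push Not at hc
    exact hφ0 (LinearMap.ext hc)
  rw [← apply_decompose_eq hφ] at hx
  refine ⟨_, SetLike.coe_mem _, hx, fun hs => hx ?_⟩
  have := hs 1
  rwa [mul_one] at this

theorem IsStandardGraded.quotient (h : IsStandardGraded 𝒢) {I : Ideal R}
    (hI : I.IsHomogeneous 𝒢) (hI1 : I ≠ ⊤) :
    letI := quotientGradedAlgebra 𝒢 I hI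
    IsStandardGraded (quotientGrading 𝒢 I) := by
  let _ := quotientGradedAlgebra 𝒢 I hI
  have := h.finite_one
  refine ⟨Ideal.Quotient.nontrivial_iff.2 hI1, ?_, ?_, ?_⟩
  · rw [quotientGrading, h.zero_eq, Submodule.map_one]
  · exact inferInstanceAs (Module.Finite k ((𝒢 1).map _))
  · have h1 : (quotientGrading 𝒢 I 1 : Set (R ⧸ I)) = Ideal.Quotient.mkₐ k I '' (𝒢 1) := rfl
    rw [h1, ← AlgHom.map_adjoin, h.adjoin_one, Algebra.map_top, AlgHom.range_eq_top]
    exact Ideal.Quotient.mkₐ_surjective k I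

/-- The quotient of a standard graded algebra by the apolar ideal of a nonzero functional that is
homogeneous of degree `e` is artinian Gorenstein. -/
theorem isArtinianGorenstein_quotient_apolarIdeal (h : IsStandardGraded 𝒢)
    (hφ : ∀ i, i ≠ e → ∀ x ∈ 𝒢 i, φ x = 0) (hφ0 : φ ≠ 0) :
    letI := quotientGradedAlgebra 𝒢 (apolarIdeal φ) (isHomogeneous_apolarIdeal hφ)
    IsArtinianGorenstein (quotientGrading 𝒢 (apolarIdeal φ)) := by
  let _ := quotientGradedAlgebra 𝒢 (apolarIdeal φ) (isHomogeneous_apolarIdeal hφ)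
  obtain ⟨s, hs, hφs, hsI⟩ := exists_mem_notMem_apolarIdeal hφ hφ0
  have hstd := h.quotient (isHomogeneous_apolarIdeal hφ) fun htop => hsI (htop ▸ Submodule.mem_top)
  refine ⟨hstd, ?_, ?_⟩
  · have hfin : Module.Finite k (R ⧸ apolarIdeal φ) := by
      have htop := (DirectSum.Decomposition.isInternal
        (quotientGrading 𝒢 (apolarIdeal φ))).submodule_iSup_eq_top
      refine ⟨?_⟩
      rw [← htop]
      have heq : ⨆ i, quotientGrading 𝒢 (apolarIdeal φ) i =
          ⨆ i ∈ Finset.range (e + 1), quotientGrading 𝒢 (apolarIdeal φ) i := by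
        refine le_antisymm (iSup_le fun i => ?_) (iSup₂_le fun i _ => le_iSup _ i)
        rcases Nat.lt_or_ge e i with hi | hi
        · rw [quotientGrading_apolarIdeal_eq_bot hφ hi]
          exact bot_le
        · exact le_iSup₂_of_le i (Finset.mem_range.2 (by omega)) le_rfl
      rw [heq]
      exact Submodule.fg_biSup _ _ fun i _ => Module.Finite.iff_fg.1 (hstd.finiteDimensional i)
    exact IsArtinianRing.of_finite k _
  · -- the functional `φ` is injective on the socle
    have hinj : ∀ f : R, Ideal.Quotient.mk (apolarIdeal φ) f ∈
        gradedSocle (quotientGrading 𝒢 (apolarIdeal φ)) → φ f = 0 → f ∈ apolarIdeal φ := by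
      intro f hf hf0
      refine mem_apolarIdeal.2 fun g => ?_
      induction g using DirectSum.Decomposition.inductionOn 𝒢 with
      | zero => simp
      | @homogeneous j g =>
        rcases Nat.eq_zero_or_pos j with rfl | hj
        · have hg : (g : R) ∈ (1 : Submodule k R) := h.zero_eq ▸ g.2
          obtain ⟨c, hc⟩ := Submodule.mem_one.1 hg
          rw [← hc, mul_comm, ← Algebra.smul_def, map_smul, hf0, smul_zero]
        · have h1 := hf j hj _ (mk_mem_quotientGrading 𝒢 (apolarIdeal φ) g.2)
          rw [← map_mul, Ideal.Quotient.eq_zero_iff_mem] at h1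
          have h2 := h1 1
          rwa [mul_one, mul_comm] at h2
      | add x y hx hy => rw [mul_add, map_add, hx, hy, add_zero]
    have hsoc : Ideal.Quotient.mk (apolarIdeal φ) s ∈
        gradedSocle (quotientGrading 𝒢 (apolarIdeal φ)) := by
      rintro i hi _ ⟨x, hx, rfl⟩
      exact Ideal.Quotient.eq_zero_iff_mem.2
        (mem_apolarIdeal_of_lt hφ (show e < i + e by omega) (SetLike.mul_mem_graded hx hs))
    refine (finrank_eq_one_iff_of_nonzero'
      (⟨_, hsoc⟩ : gradedSocle (quotientGrading 𝒢 (apolarIdeal φ))) fun h0 => hsI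
        (Ideal.Quotient.eq_zero_iff_mem.1 (congrArg Subtype.val h0))).2 ?_
    rintro ⟨w, hw⟩
    obtain ⟨f, rfl⟩ := Ideal.Quotient.mk_surjective w
    refine ⟨φ f / φ s, Subtype.ext ?_⟩
    change (φ f / φ s) • Ideal.Quotient.mk (apolarIdeal φ) s = Ideal.Quotient.mk _ f
    have hlin : Ideal.Quotient.mk (apolarIdeal φ) (f - (φ f / φ s) • s) =
        Ideal.Quotient.mk _ f - (φ f / φ s) • Ideal.Quotient.mk (apolarIdeal φ) s :=
      map_sub _ _ _
    have hmem := hinj (f - (φ f / φ s) • s)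
      (hlin ▸ sub_mem hw (Submodule.smul_mem _ _ hsoc))
      (by rw [map_sub, map_smul, smul_eq_mul, div_mul_cancel₀ _ hφs, sub_self])
    rw [← Ideal.Quotient.eq_zero_iff_mem, hlin, sub_eq_zero] at hmem
    exact hmem.symm

end Apolar

/-! ### Existence -/

section PowerSum

open MvPolynomial

variable (k : Type u) [Field k] (r : ℕ)

attribute [local instance] MvPolynomial.gradedAlgebra

theorem isStandardGraded_mvPolynomial :
    IsStandardGraded (homogeneousSubmodule (Fin r) k) := by
  refine ⟨inferInstance, ?_, ?_, ?_⟩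
  · ext p
    rw [mem_homogeneousSubmodule, ← totalDegree_zero_iff_isHomogeneous, totalDegree_eq_zero_iff_eq_C,
      Submodule.mem_one]
    constructor
    · exact fun h => ⟨_, h.symm⟩
    · rintro ⟨c, rfl⟩
      simp [algebraMap_eq]
  · rw [homogeneousSubmodule_one_eq_span_X]
    exact Module.Finite.iff_fg.2 (Submodule.fg_span (Set.finite_range _))
  · refine top_unique ?_
    rw [← adjoin_range_X]
    refine Algebra.adjoin_mono ?_
    rintro _ ⟨i, rfl⟩
    exact isHomogeneous_X k i

theorem finrank_homogeneousSubmodule_one :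
    finrank k (homogeneousSubmodule (Fin r) k 1) = r := by
  rw [homogeneousSubmodule_one_eq_span_X, finrank_span_eq_card, Fintype.card_fin]
  have h := (basisMonomials (Fin r) k).linearIndependent.comp
    (fun i : Fin r => Finsupp.single i 1) fun i j hij => by
      exact (Finsupp.single_left_inj one_ne_zero).1 hij
  convert h using 1
  funext i
  simp [X]

/-- The functional dual to the power sum `x_1 ^ e + ... + x_r ^ e`: it adds up the coefficients of
the `e`-th powers of the variables. -/
noncomputable def powerSumFunctional (e : ℕ) : MvPolynomial (Fin r) k →ₗ[k] k :=
  ∑ i, lcoeff k (Finsupp.single i e)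

variable {k r}

theorem powerSumFunctional_eq_zero {e i : ℕ} (hi : i ≠ e) (p : MvPolynomial (Fin r) k)
    (hp : p ∈ homogeneousSubmodule (Fin r) k i) : powerSumFunctional k r e p = 0 := by
  rw [powerSumFunctional, LinearMap.sum_apply]
  refine Finset.sum_eq_zero fun j _ => ?_
  exact IsHomogeneous.coeff_eq_zero hp (by rw [Finsupp.degree_single]; exact hi.symm)

theorem powerSumFunctional_X_mul_X_pow {e : ℕ} (he : 0 < e) (i j : Fin r) :
    powerSumFunctional k r (e + 1) (X i * X j ^ e) = if i = j then 1 else 0 := by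
  rw [powerSumFunctional, LinearMap.sum_apply]
  have h : ∀ l : Fin r, lcoeff k (Finsupp.single l (e + 1)) (X i * X j ^ e) =
      if i = j ∧ l = j then 1 else 0 := fun l => by
    change coeff _ _ = _
    rw [X_pow_eq_monomial, X, monomial_mul, coeff_monomial, one_mul]
    refine if_congr ⟨fun h => ?_, ?_⟩ rfl rfl
    · have hi := DFunLike.congr_fun h i
      simp only [Finsupp.add_apply, Finsupp.single_apply, if_true] at hi
      have hli : l = i := by
        by_contra hne
        rw [if_neg hne] at hi
        omega
      have hji : j = i := by
        by_contra hne
        rw [if_neg hne, if_pos hli] at hi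
        omega
      exact ⟨hji.symm, hli.trans hji.symm⟩
    · rintro ⟨rfl, rfl⟩
      rw [← Finsupp.single_add, add_comm]
  simp_rw [h]
  split_ifs with hij <;> simp [hij]

/-- There are artinian Gorenstein algebras of every codimension `r ≥ 1` and socle degree
`e ≥ 2`. -/
theorem gorensteinDegreeTwoEntries_nonempty {e : ℕ} (hr : 0 < r) (he : 0 < e) :
    (gorensteinDegreeTwoEntries k r (e + 1)).Nonempty := by
  let φ := powerSumFunctional k r (e + 1)
  have hφ : ∀ i, i ≠ e + 1 → ∀ x ∈ homogeneousSubmodule (Fin r) k i, φ x = 0 :=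
    fun i hi x hx => powerSumFunctional_eq_zero hi x hx
  have hφ0 : φ ≠ 0 := fun h0 => by
    have h1 := powerSumFunctional_X_mul_X_pow (k := k) he (⟨0, hr⟩ : Fin r) ⟨0, hr⟩
    change φ _ = _ at h1
    rw [h0, if_pos rfl] at h1
    exact zero_ne_one h1
  let 𝒜 := quotientGrading (homogeneousSubmodule (Fin r) k) (apolarIdeal φ)
  let _ := quotientGradedAlgebra _ (apolarIdeal φ) (isHomogeneous_apolarIdeal hφ)
  have hG : IsArtinianGorenstein 𝒜 :=
    isArtinianGorenstein_quotient_apolarIdeal (isStandardGraded_mvPolynomial k r) hφ hφ0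
  refine ⟨_, fun i => finrank k (𝒜 i), ⟨_, _, _, 𝒜, _, hG, fun _ => rfl⟩, ?_, ?_, ?_, rfl⟩
  · have hinj : Function.Injective (quotientGradingMk (homogeneousSubmodule (Fin r) k)
        (apolarIdeal φ) 1) := by
      rw [← LinearMap.ker_eq_bot, LinearMap.ker_eq_bot']
      rintro ⟨u, hu⟩ hu0
      have huI : u ∈ apolarIdeal φ := Ideal.Quotient.eq_zero_iff_mem.1 (congrArg Subtype.val hu0)
      refine Subtype.ext ?_
      rw [homogeneousSubmodule_one_eq_span_X] at hu
      obtain ⟨c, rfl⟩ := (Submodule.mem_span_range_iff_exists_fun k).1 hu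
      change ∑ i, c i • (X i : MvPolynomial (Fin r) k) = 0
      refine Finset.sum_eq_zero fun j _ => ?_
      have h1 := huI (X j ^ e)
      rw [Finset.sum_mul, map_sum, Finset.sum_eq_single j] at h1
      · rw [smul_mul_assoc, map_smul] at h1
        change c j • powerSumFunctional k r (e + 1) _ = 0 at h1
        rw [powerSumFunctional_X_mul_X_pow he, if_pos rfl, smul_eq_mul, mul_one] at h1
        rw [h1, zero_smul]
      · intro i _ hij
        rw [smul_mul_assoc, map_smul]
        change c i • powerSumFunctional k r (e + 1) _ = 0
        rw [powerSumFunctional_X_mul_X_pow he, if_neg hij, smul_zero]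
      · simp
    have hsurj : Function.Surjective (quotientGradingMk (homogeneousSubmodule (Fin r) k)
        (apolarIdeal φ) 1) := by
      rintro ⟨_, x, hx, rfl⟩
      exact ⟨⟨x, hx⟩, rfl⟩
    exact (LinearEquiv.ofBijective _ ⟨hinj, hsurj⟩).finrank_eq.symm.trans
      (finrank_homogeneousSubmodule_one k r)
  · have := hG.standard.finiteDimensional (e + 1)
    obtain ⟨s, hs, -, hsI⟩ := exists_mem_notMem_apolarIdeal hφ hφ0
    intro h0
    have h1 : 𝒜 (e + 1) = ⊥ := Submodule.finrank_eq_zero.1 h0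
    have h2 : Ideal.Quotient.mk (apolarIdeal φ) s ∈ 𝒜 (e + 1) := mk_mem_quotientGrading _ _ hs
    rw [h1, Submodule.mem_bot, Ideal.Quotient.eq_zero_iff_mem] at h2
    exact hsI h2
  · intro i hi
    change finrank k (𝒜 i) = 0
    rw [show 𝒜 i = ⊥ from quotientGrading_apolarIdeal_eq_bot hφ hi, finrank_bot]

end PowerSum

theorem theorem4 (k : Type u) [Field k] (r e : ℕ) (hr : 2 ≤ r) (he : 4 ≤ e) :
    IsLeast (gorensteinDegreeTwoEntries k r e) (leastDegreeTwoEntry k r e) ∧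
    leastDegreeTwoEntry k r e ≥
      binomialShift r (e - 1) (-1) (-1) +
        binomialShift r (e - 1) (-((e : ℤ) - 3)) (-((e : ℤ) - 2)) := by
  obtain ⟨s, rfl⟩ : ∃ s, e = s + 4 := ⟨e - 4, by omega⟩
  have hmem : leastDegreeTwoEntry k r (s + 4) ∈ gorensteinDegreeTwoEntries k r (s + 4) :=
    Nat.sInf_mem (gorensteinDegreeTwoEntries_nonempty (e := s + 3) (by omega) (by omega))
  refine ⟨⟨hmem, fun m hm => Nat.sInf_le hm⟩, ?_⟩
  obtain ⟨h, ⟨A, _, _, 𝒜, _, hG, hh⟩, h1, hne, htop, h2⟩ := hmem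
  have hfin := hG.standard.finiteDimensional
  have hne' : 𝒜 (s + 4) ≠ ⊥ := fun h0 => hne (by rw [hh, h0, finrank_bot])
  have htop' : ∀ i, s + 4 < i → 𝒜 i = ⊥ := fun i hi =>
    Submodule.finrank_eq_zero.1 ((hh i).symm.trans (htop i hi))
  have hr1 : finrank k (𝒜 1) = r := (hh 1).symm.trans h1
  have key := hG.le_finrank_two hne' htop' (by omega)
  rw [hr1, ← hh 2, h2] at key
  have e1 : -(((s + 4 : ℕ) : ℤ) - 3) = -((s : ℤ) + 1) := by push_cast; ring
  have e2 : -(((s + 4 : ℕ) : ℤ) - 2) = -((s : ℤ) + 2) := by push_cast; ring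
  rw [e1, e2]
  exact key
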